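/- Let $A$ be a totally ordered set (the alphabet). **Tableaux.** A row is a non-decreasing word in $A$. For words put $x_1\ldots x_s \succ y_1\ldots y_t$ if $s\le t$ and $x_i>y_i$ for all $1\le i\le s$. A Young tableau on $A$ is a finite $\succ$-decreasing sequence of non-empty rows, drawn from top to bottom and left-justified, so that the longest row is at the bottom. Its columns are listed from left to right, each read from top to bottom. Let $\mathbf{YT}_A$ be the set of Young tableaux on $A$, $\emptyset$ the empty tableau, and $\operatorname{rows}(T)$, $\operatorname{cols}(T)$ the numbers of rows and columns of $T$. For $T_1,T_2\in\mathbf{YT}_A$ let $T_1\ast T_2$ be the tableau obtained from $T_1$ by inserting, one after another, the letters of the row reading of $T_2$ (rows from top to bottom, each from left to right) by Schensted's right insertion: a letter $x$ is attached to the right end of the bottom row if no entry of that row exceeds $x$ (in particular if there is no row); otherwise it replaces the leftmost entry $x'>x$ of that row, and $x'$ is inserted in the same way into the tableau formed by the other rows. **Braidings.** A braiding on a set $M$ is a map $\sigma\colon M\times M\to M\times M$ with $(\sigma\times\mathrm{Id})(\mathrm{Id}\times\sigma)(\sigma\times\mathrm{Id})=(\mathrm{Id}\times\sigma)(\sigma\times\mathrm{Id})(\mathrm{Id}\times\sigma)$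 on $M^{\times 3}$; it need not be invertible. A braided commutative monoid is a monoid $(M,\cdot,1)$ with a braiding $\sigma$ such that for all $u,v,w\in M$: - $\sigma(u\cdot v,w)=(w'',u'\cdot v')$, where $\sigma(v,w)=(w',v')$ and $\sigma(u,w')=(w'',u')$; - $\sigma(u,v\cdot w)=(v'\cdot w',u'')$, where $\sigma(u,v)=(v',u')$ and $\sigma(u',w)=(w',u'')$; - $w'\cdot v'=v\cdot w$, where $\sigma(v,w)=(w',v')$; - $\sigma(v,w)=(w,v)$ whenever $v=1$ or $w=1$. **Theorem.** The set $\mathbf{YT}_A\times\mathbb{N}_0$ is a braided commutative monoid in the following two ways. 1. The unit is $(\emptyset,0)$, the product is $$(T_1,\alpha_1)\ast_R(T_2,\alpha_2)=(T_1\ast T_2,\ \alpha_1+\alpha_2+\operatorname{rows}(T_1)+\operatorname{rows}(T_2)-\operatorname{rows}(T_1\ast T_2)),$$ and the braiding $\boldsymbol\sigma_R((T_1,\alpha_1),(T_2,\alpha_2))=((T_2',\alpha_2'),(T_1',\alpha_1'))$ is uniquely defined by the following conditions: - the rows of $T_2'$ followed by those of $T_1'$ (from top to bottom) form the tableau $T_1\ast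 T_2$; - $\alpha_1'+\operatorname{rows}(T_1')=\alpha_1+\operatorname{rows}(T_1)$ and $\alpha_2'+\operatorname{rows}(T_2')=\alpha_2+\operatorname{rows}(T_2)$; - $\alpha_1'>0$ if and only if $\operatorname{rows}(T_1\ast T_2)<\alpha_1+\operatorname{rows}(T_1)$, in which case $T_2'=\emptyset$. 2. The unit is $(\emptyset,0)$, the product is $$(T_1,\alpha_1)\ast_C(T_2,\alpha_2)=(T_1\ast T_2,\ \alpha_1+\alpha_2+\operatorname{cols}(T_1)+\operatorname{cols}(T_2)-\operatorname{cols}(T_1\ast T_2)),$$ and the braiding $\boldsymbol\sigma_C((T_1,\alpha_1),(T_2,\alpha_2))=((T_2',\alpha_2'),(T_1',\alpha_1'))$ is uniquely defined by the following conditions: - the columns of $T_2'$ followed by those of $T_1'$ (from left to right) form the tableau $T_1\ast T_2$; - $\alpha_1'+\operatorname{cols}(T_1')=\alpha_1+\operatorname{cols}(T_1)$ and $\alpha_2'+\operatorname{cols}(T_2')=\alpha_2+\operatorname{cols}(T_2)$; - $\alpha_2'>0$ if and only if $\operatorname{cols}(T_1\ast T_2)<\alpha_2+\operatorname{cols}(T_2)$,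 in which case $T_1'=\emptyset$. In particular, the decorations in both product formulas are non-negative, since $\operatorname{rows}(T_1\ast T_2)\le\operatorname{rows}(T_1)+\operatorname{rows}(T_2)$ and $\operatorname{cols}(T_1\ast T_2)\le\operatorname{cols}(T_1)+\operatorname{cols}(T_2)$ for all $T_1,T_2$. -/

import Mathlib

namespace Plactic

/-! ### Young tableaux on a totally ordered alphabet -/

/-- The relation `x₁ … x_s ≻ y₁ … y_t` on words: `s ≤ t` and `x_i > y_i` for all `i ≤ s`. -/
def RowGT {A : Type*} [LinearOrder A] (x y : List A) : Prop :=
  x.length ≤ y.length ∧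
    ∀ (i : ℕ) (hx : i < x.length) (hy : i < y.length), y[i] < x[i]

/-- A Young tableau on `A`: a finite `≻`-decreasing sequence of non-empty non-decreasing words
(rows). The rows are listed from top to bottom in the French drawing, so the last element of the
list is the longest row. -/
@[ext]
structure Tableau (A : Type*) [LinearOrder A] where
  rows : List (List A)
  ne_nil : ∀ r ∈ rows, r ≠ []
  row_sorted : ∀ r ∈ rows, r.Pairwise (· ≤ ·)
  decreasing : rows.IsChain RowGT

/-- The insertion of a letter `x` into a row: the leftmost letter exceeding `x` is replaced with
`x` and returned; if there is none, then `x` is attached to the right of the row. -/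
def rowInsert {A : Type*} [LinearOrder A] : List A → A → List A × Option A
  | [], x => ([x], none)
  | y :: ys, x =>
    if x < y then (x :: ys, some y)
    else (y :: (rowInsert ys x).1, (rowInsert ys x).2)

/-- Right Schensted insertion of a letter, on rows listed from bottom to top: the letter is
inserted into the bottom row, and the letter replaced there (if any) into the tableau formed by
the other rows. -/
def insertRows {A : Type*} [LinearOrder A] : List (List A) → A → List (List A)
  | [], x => [[x]]
  | r :: rs, x =>
    match (rowInsert r x).2 with
    | none => (rowInsert r x).1 :: rs
    | some y => (rowInsert r x).1 :: insertRows rs y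

section Aux

variable {A : Type*} [LinearOrder A]

theorem rowGT_nil (y : List A) : RowGT [] y := ⟨by simp, fun i hx => by simp at hx⟩

theorem rowGT_cons {a b : A} {as bs : List A} :
    RowGT (a :: as) (b :: bs) ↔ b < a ∧ RowGT as bs := by
  constructor
  · rintro ⟨h1, h2⟩
    refine ⟨h2 0 (by simp) (by simp), by simpa using h1, fun i hx hy => ?_⟩
    exact h2 (i + 1) (by simpa using hx) (by simpa using hy)
  · rintro ⟨h0, h1, h2⟩
    refine ⟨by simpa using h1, fun i hx hy => ?_⟩
    cases i with
    | zero => simpa using h0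
    | succ i => simpa using h2 i (by simpa using hx) (by simpa using hy)

theorem not_rowGT_cons_nil {a : A} {as : List A} : ¬ RowGT (a :: as) [] := by
  rintro ⟨h, -⟩
  simp at h

theorem rowInsert_ne_nil (r : List A) (x : A) : (rowInsert r x).1 ≠ [] := by
  cases r with
  | nil => simp [rowInsert]
  | cons y ys => simp only [rowInsert]; split <;> simp

theorem mem_rowInsert {r : List A} {x z : A} (h : z ∈ (rowInsert r x).1) : z = x ∨ z ∈ r := by
  induction r with
  | nil => simpa [rowInsert] using h
  | cons y ys ih =>
    simp only [rowInsert] at h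
    split at h
    · simp only [List.mem_cons] at h ⊢; tauto
    · simp only [List.mem_cons] at h ⊢
      rcases h with h | h
      · exact Or.inr (Or.inl h)
      · rcases ih h with h | h
        · exact Or.inl h
        · exact Or.inr (Or.inr h)

theorem rowInsert_sorted {r : List A} (x : A) (h : r.Pairwise (· ≤ ·)) :
    (rowInsert r x).1.Pairwise (· ≤ ·) := by
  induction r with
  | nil => simp [rowInsert]
  | cons y ys ih =>
    rw [List.pairwise_cons] at h
    simp only [rowInsert]
    split
    · rename_i hxy
      exact List.pairwise_cons.2 ⟨fun z hz => hxy.le.trans (h.1 z hz), h.2⟩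
    · rename_i hxy
      refine List.pairwise_cons.2 ⟨fun z hz => ?_, ih h.2⟩
      rcases mem_rowInsert hz with rfl | hz
      · exact not_lt.1 hxy
      · exact h.1 z hz

theorem lt_of_rowInsert {r : List A} {x y : A} (h : (rowInsert r x).2 = some y) : x < y := by
  induction r with
  | nil => simp [rowInsert] at h
  | cons z zs ih =>
    simp only [rowInsert] at h
    split at h
    · rename_i hxz
      obtain rfl : z = y := by simpa using h
      exact hxz
    · exact ih h

theorem rowGT_rowInsert_right {s r : List A} (x : A) (h : RowGT s r) :
    RowGT s (rowInsert r x).1 := by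
  induction r generalizing s with
  | nil =>
    cases s with
    | nil => exact rowGT_nil _
    | cons a as => exact absurd h not_rowGT_cons_nil
  | cons b bs ih =>
    cases s with
    | nil => exact rowGT_nil _
    | cons a as =>
      rw [rowGT_cons] at h
      simp only [rowInsert]
      split
      · rename_i hxb
        exact rowGT_cons.2 ⟨hxb.trans h.1, h.2⟩
      · exact rowGT_cons.2 ⟨h.1, ih h.2⟩

theorem rowGT_rowInsert_rowInsert {s r : List A} {x y : A} (h : RowGT s r)
    (hy : (rowInsert r x).2 = some y) : RowGT (rowInsert s y).1 (rowInsert r x).1 := by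
  induction r generalizing s with
  | nil => simp [rowInsert] at hy
  | cons b bs ih =>
    have hxy := lt_of_rowInsert hy
    simp only [rowInsert] at hy ⊢
    split at hy
    · rename_i hxb
      obtain rfl : b = y := by simpa using hy
      rw [if_pos hxb]
      cases s with
      | nil => exact rowGT_cons.2 ⟨hxb, rowGT_nil _⟩
      | cons a as =>
        rw [rowGT_cons] at h
        simp only [rowInsert, if_pos h.1]
        exact rowGT_cons.2 ⟨hxb, h.2⟩
    · rename_i hxb
      have hby : b < y := (not_lt.1 hxb).trans_lt hxy
      rw [if_neg hxb]
      cases s with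
      | nil => exact rowGT_cons.2 ⟨hby, rowGT_nil _⟩
      | cons a as =>
        rw [rowGT_cons] at h
        simp only [rowInsert]
        split
        · exact rowGT_cons.2 ⟨hby, rowGT_rowInsert_right x h.2⟩
        · exact rowGT_cons.2 ⟨h.1, ih h.2 hy⟩

theorem insertRows_ne_nil {rs : List (List A)} (x : A) (h : ∀ r ∈ rs, r ≠ []) :
    ∀ r ∈ insertRows rs x, r ≠ [] := by
  induction rs generalizing x with
  | nil => simp [insertRows]
  | cons r rs ih =>
    rw [List.forall_mem_cons] at h
    simp only [insertRows]
    split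
    · exact List.forall_mem_cons.2 ⟨rowInsert_ne_nil r x, h.2⟩
    · exact List.forall_mem_cons.2 ⟨rowInsert_ne_nil r x, ih _ h.2⟩

theorem insertRows_sorted {rs : List (List A)} (x : A)
    (h : ∀ r ∈ rs, r.Pairwise (· ≤ ·)) : ∀ r ∈ insertRows rs x, r.Pairwise (· ≤ ·) := by
  induction rs generalizing x with
  | nil => simp [insertRows]
  | cons r rs ih =>
    rw [List.forall_mem_cons] at h
    simp only [insertRows]
    split
    · exact List.forall_mem_cons.2 ⟨rowInsert_sorted x h.1, h.2⟩
    · exact List.forall_mem_cons.2 ⟨rowInsert_sorted x h.1, ih _ h.2⟩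

theorem insertRows_isChain {rs : List (List A)} (x : A)
    (h : rs.IsChain (fun a b => RowGT b a)) :
    (insertRows rs x).IsChain (fun a b => RowGT b a) := by
  induction rs generalizing x with
  | nil => simp [insertRows]
  | cons r rs ih =>
    simp only [insertRows]
    split
    · cases rs with
      | nil => simp
      | cons s ss =>
        rw [List.isChain_cons_cons] at h ⊢
        exact ⟨rowGT_rowInsert_right x h.1, h.2⟩
    · rename_i y hy
      cases rs with
      | nil =>
        have := rowGT_rowInsert_rowInsert (rowGT_nil r) hy
        simpa [insertRows, rowInsert] using this
      | cons s ss =>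
        rw [List.isChain_cons_cons] at h
        have h2 := ih y h.2
        have h3 := rowGT_rowInsert_rowInsert h.1 hy
        simp only [insertRows] at h2 ⊢
        split at h2 <;> exact List.isChain_cons_cons.2 ⟨h3, h2⟩

end Aux

namespace Tableau

/-- The empty tableau. -/
def empty (A : Type*) [LinearOrder A] : Tableau A where
  rows := []
  ne_nil := by simp
  row_sorted := by simp
  decreasing := by simp

/-- The right Schensted insertion of a letter into a tableau. -/
def insert {A : Type*} [LinearOrder A] (T : Tableau A) (x : A) : Tableau A where
  rows := (insertRows T.rows.reverse x).reverse
  ne_nil r hr := insertRows_ne_nil x (fun s hs => T.ne_nil s (List.mem_reverse.1 hs)) r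
    (List.mem_reverse.1 hr)
  row_sorted r hr := insertRows_sorted x (fun s hs => T.row_sorted s (List.mem_reverse.1 hs)) r
    (List.mem_reverse.1 hr)
  decreasing := List.isChain_reverse.2 (insertRows_isChain x (List.isChain_reverse.2 T.decreasing))

/-- The insertion map: the letters of a word are inserted one after another, from left to right. -/
def insertWord {A : Type*} [LinearOrder A] (T : Tableau A) (w : List A) : Tableau A :=
  w.foldl insert T

/-- The row reading of a tableau: the rows are read from top to bottom, each from left to right. -/
def rowReading {A : Type*} [LinearOrder A] (T : Tableau A) : List A :=
  T.rows.flatten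

/-- The product `T ∗ T'` of tableaux: the row reading of `T'` is inserted into `T`. -/
def star {A : Type*} [LinearOrder A] (T T' : Tableau A) : Tableau A :=
  T.insertWord T'.rowReading

/-- The number of rows of a tableau. -/
def numRows {A : Type*} [LinearOrder A] (T : Tableau A) : ℕ :=
  T.rows.length

/-- The number of columns of a tableau, i.e. the length of its bottom row. -/
def numCols {A : Type*} [LinearOrder A] (T : Tableau A) : ℕ :=
  (T.rows.getLast?.getD []).length

/-- The columns of a tableau, from left to right, each read from top to bottom. -/
def cols {A : Type*} [LinearOrder A] (T : Tableau A) : List (List A) :=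
  (List.range T.numCols).map fun j => T.rows.filterMap fun r => r[j]?

end Tableau

/-! ### Braidings and braided commutative monoids -/

/-- `σ × Id` on `M × M × M`. -/
def onFirstTwo {M : Type*} (σ : M × M → M × M) (t : M × M × M) : M × M × M :=
  ((σ (t.1, t.2.1)).1, (σ (t.1, t.2.1)).2, t.2.2)

/-- `Id × σ` on `M × M × M`. -/
def onLastTwo {M : Type*} (σ : M × M → M × M) (t : M × M × M) : M × M × M :=
  (t.1, σ t.2)

/-- A braiding on a set: a (not necessarily invertible) solution of the Yang–Baxter equation. -/
def IsBraiding {M : Type*} (σ : M × M → M × M) : Prop :=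
  ∀ t : M × M × M, onFirstTwo σ (onLastTwo σ (onFirstTwo σ t)) =
    onLastTwo σ (onFirstTwo σ (onLastTwo σ t))

/-- The set `M` with the product `mul`, the unit `one` and the braiding `σ` is a braided
commutative monoid. -/
structure IsBraidedCommMonoid {M : Type*} (mul : M → M → M) (one : M)
    (σ : M × M → M × M) : Prop where
  mul_assoc : ∀ u v w, mul (mul u v) w = mul u (mul v w)
  one_mul : ∀ u, mul one u = u
  mul_one : ∀ u, mul u one = u
  braiding : IsBraiding σ
  braid_mul_left : ∀ u v w w' v' w'' u', σ (v, w) = (w', v') → σ (u, w') = (w'', u') →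
    σ (mul u v, w) = (w'', mul u' v')
  braid_mul_right : ∀ u v w v' u' w' u'', σ (u, v) = (v', u') → σ (u', w) = (w', u'') →
    σ (u, mul v w) = (mul v' w', u'')
  braided_comm : ∀ v w w' v', σ (v, w) = (w', v') → mul w' v' = mul v w
  braid_one_left : ∀ w, σ (one, w) = (w, one)
  braid_one_right : ∀ v, σ (v, one) = (one, v)

/-! ### Decorated Young tableaux -/

/-- `ℕ`-decorated Young tableaux. -/
abbrev DecTableau (A : Type*) [LinearOrder A] := Tableau A × ℕ

/-- The row product `∗_R` on decorated tableaux. -/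
def rowMul {A : Type*} [LinearOrder A] (p q : DecTableau A) : DecTableau A :=
  (p.1.star q.1, p.2 + q.2 + p.1.numRows + q.1.numRows - (p.1.star q.1).numRows)

/-- The column product `∗_C` on decorated tableaux. -/
def colMul {A : Type*} [LinearOrder A] (p q : DecTableau A) : DecTableau A :=
  (p.1.star q.1, p.2 + q.2 + p.1.numCols + q.1.numCols - (p.1.star q.1).numCols)

/-- The conditions on the value `((T₂', α₂'), (T₁', α₁'))` of the row braiding at
`((T₁, α₁), (T₂, α₂))`. -/
structure IsRowBraidValue {A : Type*} [LinearOrder A] (T₁ : Tableau A) (α₁ : ℕ)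
    (T₂ : Tableau A) (α₂ : ℕ) (T₂' : Tableau A) (α₂' : ℕ) (T₁' : Tableau A) (α₁' : ℕ) :
    Prop where
  rows_append : T₂'.rows ++ T₁'.rows = (T₁.star T₂).rows
  size_fst : α₁' + T₁'.numRows = α₁ + T₁.numRows
  size_snd : α₂' + T₂'.numRows = α₂ + T₂.numRows
  pos_iff : 0 < α₁' ↔ (T₁.star T₂).numRows < α₁ + T₁.numRows
  eq_empty : (T₁.star T₂).numRows < α₁ + T₁.numRows → T₂' = Tableau.empty A

/-- The conditions on the value `((T₂', α₂'), (T₁', α₁'))` of the column braiding at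
`((T₁, α₁), (T₂, α₂))`. -/
structure IsColBraidValue {A : Type*} [LinearOrder A] (T₁ : Tableau A) (α₁ : ℕ)
    (T₂ : Tableau A) (α₂ : ℕ) (T₂' : Tableau A) (α₂' : ℕ) (T₁' : Tableau A) (α₁' : ℕ) :
    Prop where
  cols_append : T₂'.cols ++ T₁'.cols = (T₁.star T₂).cols
  size_fst : α₁' + T₁'.numCols = α₁ + T₁.numCols
  size_snd : α₂' + T₂'.numCols = α₂ + T₂.numCols
  pos_iff : 0 < α₂' ↔ (T₁.star T₂).numCols < α₂ + T₂.numCols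
  eq_empty : (T₁.star T₂).numCols < α₂ + T₂.numCols → T₁' = Tableau.empty A

end Plactic

/-!
A decorated tableau `(T, α)` is the same thing as a tableau padded with `α` empty rows on top. In
this form, let the rows of `T₂`, from top to bottom, be inserted one after another into `T₁` while
the number of rows of `T₁` is kept fixed: each row of `T₂` is turned into the row of letters pushed
out at the top of `T₁`. The rows pushed out, put on top of what has become of `T₁`, form the
product, and the two parts are the two components of the braiding (`passRows`). The reason is that
two rows that lie above each other still do so after they have been passed through a third row
(`above_pass_pass`), and that a row pushed out lies above the row it leaves behind (`above_pass`),
so that the result is again a stack of rows (`isStack_passRows`).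

A padded tableau is determined by its number of rows and the plactic class of its reading
(`IsStack.eq_of_cls_eq`), because row insertion respects the Knuth relations
(`PlacticEquiv.pass`), and passing stacks through stacks preserves the plactic class
(`cls_passRows`). Hence each axiom, and the Yang–Baxter equation, reduces to the statement that
certain pieces, put on top of each other, form a stack. The latter holds because passing a
composite stack, or passing through one, may be done piece by piece (`passRows_append_left`,
`passRows_append_right`).

Everything is done for words sorted with respect to a relation `R` that is transitive and
cotransitive. For `R = (≤)` this is the row structure. For `R = (<)` it is the opposite of the
column structure: the columns of a tableau, read from bottom to top, are sorted for `<`, reversal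
exchanges the Knuth relations of `≤` and `<` (`PlacticEquiv.reverse`), and the row reading of a
tableau is plactic equivalent to its column reading (`cls_flatten_eq_columns`).
-/

namespace Plactic

/-! ### Row relations and plactic equivalence -/

/-- A transitive and cotransitive relation. The two instances that matter are `≤`, whose sorted
words are the rows of tableaux, and `<`, whose sorted words are the columns read from bottom to
top. -/
class RowRelation {A : Type*} (R : A → A → Prop) : Prop where
  trans : ∀ {a b c}, R a b → R b c → R a c
  cotrans : ∀ {a b c}, R a c → R a b ∨ R b c

instance {A : Type*} [LinearOrder A] : RowRelation (fun a b : A => a ≤ b) where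
  trans := le_trans
  cotrans {a b c} h := by
    by_contra! hn
    exact absurd (hn.2.trans hn.1) h.not_gt

instance {A : Type*} [LinearOrder A] : RowRelation (fun a b : A => a < b) where
  trans := lt_trans
  cotrans {a b c} h := by
    by_contra! hn
    exact absurd (hn.2.trans hn.1) h.not_ge

/-- The congruence on words generated by the Knuth relations of `R`. For `R = (≤)` this is the
plactic congruence; for `R = (<)` it is the image of the plactic congruence under reversal. -/
inductive PlacticEquiv {A : Type*} (R : A → A → Prop) : List A → List A → Prop
  | swap_right {x y z : A} : R x y → ¬ R z y → PlacticEquiv R [x, z, y] [z, x, y]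
  | swap_left {x y z : A} : ¬ R y x → R y z → PlacticEquiv R [y, x, z] [y, z, x]
  | refl (w : List A) : PlacticEquiv R w w
  | symm {v w : List A} : PlacticEquiv R v w → PlacticEquiv R w v
  | trans {u v w : List A} : PlacticEquiv R u v → PlacticEquiv R v w → PlacticEquiv R u w
  | append {u v w x : List A} : PlacticEquiv R u v → PlacticEquiv R w x →
      PlacticEquiv R (u ++ w) (v ++ x)

/-- Plactic equivalence as a congruence on the free monoid. -/
def placticCon {A : Type*} (R : A → A → Prop) : Con (FreeMonoid A) where
  r v w := PlacticEquiv R v.toList w.toList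
  iseqv := ⟨fun w => .refl w.toList, .symm, .trans⟩
  mul' h₁ h₂ := by simpa using h₁.append h₂

/-- The class of a word in the plactic monoid. -/
def cls {A : Type*} (R : A → A → Prop) (w : List A) : (placticCon R).Quotient :=
  (FreeMonoid.ofList w : FreeMonoid A)

section

variable {A : Type*} {R : A → A → Prop}

theorem cls_eq {v w : List A} : cls R v = cls R w ↔ PlacticEquiv R v w :=
  (placticCon R).eq

theorem cls_append (v w : List A) : cls R (v ++ w) = cls R v * cls R w := rfl

theorem cls_nil : cls R [] = 1 := rfl

theorem cls_cons (a : A) (w : List A) : cls R (a :: w) = cls R [a] * cls R w := rfl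

/-- Reversing words turns the Knuth relations of `R` into those of the complement of the converse
of `R`, so it exchanges the relations of `≤` and `<`. -/
theorem PlacticEquiv.reverse {S : A → A → Prop} (hRS : ∀ a b, S a b ↔ ¬ R b a) {v w : List A}
    (h : PlacticEquiv R v w) : PlacticEquiv S v.reverse w.reverse := by
  induction h with
  | swap_right h₁ h₂ =>
    exact (PlacticEquiv.swap_left (fun h => (hRS _ _).1 h h₁) ((hRS _ _).2 h₂)).symm
  | swap_left h₁ h₂ =>
    exact (PlacticEquiv.swap_right ((hRS _ _).2 h₁) fun h => (hRS _ _).1 h h₂).symm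
  | refl w => exact .refl _
  | symm _ ih => exact ih.symm
  | trans _ _ ih₁ ih₂ => exact ih₁.trans ih₂
  | append _ _ ih₁ ih₂ => simpa using ih₂.append ih₁

theorem cls_reverse_eq_iff [LinearOrder A] {v w : List A} :
    cls (fun a b : A => a < b) v.reverse = cls (fun a b : A => a < b) w.reverse ↔
      cls (fun a b : A => a ≤ b) v = cls (fun a b : A => a ≤ b) w := by
  rw [cls_eq, cls_eq]
  refine ⟨fun h => ?_, fun h => h.reverse fun _ _ => not_le.symm⟩
  simpa using h.reverse fun _ _ => not_lt.symm

theorem RowRelation.of_not_left [RowRelation R] {a b c : A} (h : R a c) (hn : ¬ R b c) : R a b :=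
  (RowRelation.cotrans h).resolve_right hn

theorem RowRelation.of_not_right [RowRelation R] {a b c : A} (h : R a c) (hn : ¬ R a b) : R b c :=
  (RowRelation.cotrans h).resolve_left hn

end

open RowRelation

/-! ### Insertion into a single row -/

/-- Insertion of the letter `x` into a row. The second component is the word of length at most
one that holds the letter replaced, i.e. the leftmost `y` with `¬ R y x`. -/
def push {A : Type*} (R : A → A → Prop) [DecidableRel R] : List A → A → List A × List A
  | [], x => ([x], [])
  | y :: ys, x => if R y x then (y :: (push R ys x).1, (push R ys x).2) else (x :: ys, [y])

/-- Insertion of a word into a row, letter by letter; the second component collects the letters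
replaced. -/
def pass {A : Type*} (R : A → A → Prop) [DecidableRel R] : List A → List A → List A × List A
  | r, [] => (r, [])
  | r, x :: w => ((pass R (push R r x).1 w).1, (push R r x).2 ++ (pass R (push R r x).1 w).2)

/-- `Above R z y`: the word `z` may be put on top of `y` in a tableau, i.e. `z` is not longer
than `y` and `¬ R z_i y_i` for all positions `i` of `z`. -/
def Above {A : Type*} (R : A → A → Prop) : List A → List A → Prop
  | [], _ => True
  | _ :: _, [] => False
  | a :: as, b :: bs => ¬ R a b ∧ Above R as bs

section Rows

variable {A : Type*} {R : A → A → Prop} [DecidableRel R]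

@[simp] theorem pass_nil (r : List A) : pass R r [] = (r, []) := rfl

theorem pass_append (r v w : List A) : pass R r (v ++ w) =
    ((pass R (pass R r v).1 w).1, (pass R r v).2 ++ (pass R (pass R r v).1 w).2) := by
  induction v generalizing r with
  | nil => simp
  | cons x v ih => simp [pass, ih]

omit [DecidableRel R] in
@[simp] theorem above_nil (y : List A) : Above R [] y := by simp [Above]

omit [DecidableRel R] in
theorem above_cons {a b : A} {as bs : List A} :
    Above R (a :: as) (b :: bs) ↔ ¬ R a b ∧ Above R as bs := Iff.rfl

theorem mem_push {r : List A} {x e : A} (h : e ∈ (push R r x).1) : e = x ∨ e ∈ r := by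
  induction r with
  | nil => simpa [push] using h
  | cons a r ih =>
    simp only [push] at h
    split_ifs at h
    · rcases List.mem_cons.1 h with h | h
      · simp [h]
      · rcases ih h with h | h <;> simp [h]
    · simp only [List.mem_cons] at h ⊢; tauto

theorem mem_push_snd {r : List A} {x c : A} (h : c ∈ (push R r x).2) : c ∈ r ∧ ¬ R c x := by
  induction r with
  | nil => simp [push] at h
  | cons a r ih =>
    simp only [push] at h
    split_ifs at h with hax
    · exact ⟨List.mem_cons_of_mem _ (ih h).1, (ih h).2⟩
    · obtain rfl : c = a := by simpa using h
      exact ⟨by simp, hax⟩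

theorem push_snd_eq (r : List A) (x : A) : (push R r x).2 = [] ∨ ∃ c, (push R r x).2 = [c] := by
  induction r with
  | nil => simp [push]
  | cons a r ih =>
    simp only [push]
    split_ifs
    · exact ih
    · simp

theorem length_push_of_snd {r : List A} {x c : A} (h : (push R r x).2 = [c]) :
    (push R r x).1.length = r.length := by
  induction r with
  | nil => simp [push] at h
  | cons a r ih =>
    simp only [push] at h ⊢
    split_ifs at h ⊢ with hax
    · simp [ih h]
    · simp

variable [RowRelation R]

theorem sorted_push {r : List A} (x : A) (h : r.Pairwise R) : (push R r x).1.Pairwise R := by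
  induction r with
  | nil => simp [push]
  | cons a r ih =>
    rw [List.pairwise_cons] at h
    simp only [push]
    split_ifs with hax
    · refine List.pairwise_cons.2 ⟨fun e he => ?_, ih h.2⟩
      rcases mem_push he with rfl | he
      · exact hax
      · exact h.1 e he
    · exact List.pairwise_cons.2 ⟨fun e he => of_not_right (h.1 e he) hax, h.2⟩

theorem sorted_pass {r : List A} (w : List A) (h : r.Pairwise R) : (pass R r w).1.Pairwise R := by
  induction w generalizing r with
  | nil => exact h
  | cons x w ih => exact ih (sorted_push x h)

omit [RowRelation R] in
/-- When `¬ R z y`, inserting `y` after `z` replaces `z` or a letter to the left of `z`. -/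
theorem push_push_of_not {r : List A} {y z : A} (hr : r.Pairwise R) (h : ¬ R z y) :
    ∃ d, (push R (push R r z).1 y).2 = [d] ∧ (d = z ∨ R d z) ∧ (d = z ∨ d ∈ r) := by
  induction r with
  | nil => simp [push, h]
  | cons a r ih =>
    rw [List.pairwise_cons] at hr
    by_cases haz : R a z
    · by_cases hay : R a y
      · obtain ⟨d, h₁, h₂, h₃⟩ := ih hr.2
        exact ⟨d, by simp [push, haz, hay, h₁], h₂, h₃.imp_right (List.mem_cons_of_mem _)⟩
      · exact ⟨a, by simp [push, haz, hay], .inr haz, by simp⟩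
    · exact ⟨z, by simp [push, haz, h], by simp, by simp⟩

/-- When `R y z`, inserting `z` after `y` replaces nothing, or a letter to the right of the one
that `y` has replaced. -/
theorem push_push_of_rel {r : List A} {y z d : A} (hr : r.Pairwise R) (h : R y z)
    (hd : (push R (push R r y).1 z).2 = [d]) :
    ∃ c, (push R r y).2 = [c] ∧ R c d ∧ d ∈ r := by
  induction r with
  | nil => simp [push, h] at hd
  | cons a r ih =>
    rw [List.pairwise_cons] at hr
    by_cases hay : R a y
    · have haz := RowRelation.trans hay h
      simp only [push, hay, haz, if_true] at hd ⊢
      obtain ⟨c, h₁, h₂, h₃⟩ := ih hr.2 hd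
      exact ⟨c, h₁, h₂, List.mem_cons_of_mem _ h₃⟩
    · simp only [push, hay, h, if_true, if_false] at hd ⊢
      have hmem : d ∈ r := (mem_push_snd (R := R) (x := z) (by simp [hd])).1
      exact ⟨a, rfl, hr.1 d hmem, List.mem_cons_of_mem _ hmem⟩

/-! ### Invariance of row insertion under plactic equivalence -/

theorem pass_swap_right {r : List A} (hr : r.Pairwise R) {x y z : A} (hxy : R x y)
    (hzy : ¬ R z y) : (pass R r [x, z, y]).1 = (pass R r [z, x, y]).1 ∧
      PlacticEquiv R (pass R r [x, z, y]).2 (pass R r [z, x, y]).2 := by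
  have hxz : R x z := of_not_left hxy hzy
  have hzx : ¬ R z x := fun h => hzy (RowRelation.trans h hxy)
  induction r with
  | nil => simp [pass, push, hxy, hxz, hzx, hzy, PlacticEquiv.refl]
  | cons a r ih =>
    rw [List.pairwise_cons] at hr
    by_cases hax : R a x
    · have hay := RowRelation.trans hax hxy
      have haz := RowRelation.trans hax hxz
      simpa [pass, push, hax, hay, haz] using ih hr.2
    by_cases haz : R a z
    · simp only [pass, push, hax, haz, hxy, hxz, if_true, if_false, List.append_nil, true_and]
      rcases push_snd_eq (R := R) r z with hc | ⟨c, hc⟩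
      · rw [hc]
        exact .refl _
      · obtain ⟨d, h₁, h₂, h₃⟩ := push_push_of_not hr.2 hzy
        have hcz := (mem_push_snd (R := R) (r := r) (x := z) (c := c) (by simp [hc])).2
        rw [h₁, hc]
        refine .swap_right ?_ fun hcd => hcz ?_
        · rcases h₃ with rfl | h₃
          · exact haz
          · exact hr.1 d h₃
        · rcases h₂ with rfl | h₂
          · exact hcd
          · exact RowRelation.trans hcd h₂
    · cases r with
      | nil => simp [pass, push, hax, haz, hxy, hxz, hzx, hzy, PlacticEquiv.refl]
      | cons e r =>
        have hae : R a e := hr.1 e (by simp)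
        have hez : ¬ R e z := fun h => haz (RowRelation.trans hae h)
        have hey : ¬ R e y := fun h => hez (of_not_left h hzy)
        simp only [pass, push, hax, haz, hez, hey, hxy, hxz, hzx, hzy, if_true, if_false,
          List.append_nil, true_and]
        exact (PlacticEquiv.swap_left haz hae).symm

theorem pass_swap_left {r : List A} (hr : r.Pairwise R) {x y z : A} (hyx : ¬ R y x)
    (hyz : R y z) : (pass R r [y, x, z]).1 = (pass R r [y, z, x]).1 ∧
      PlacticEquiv R (pass R r [y, x, z]).2 (pass R r [y, z, x]).2 := by
  have hxz : R x z := of_not_right hyz hyx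
  have hzx : ¬ R z x := fun h => hyx (RowRelation.trans hyz h)
  induction r with
  | nil => simp [pass, push, hyx, hxz, hyz, PlacticEquiv.refl]
  | cons a r ih =>
    rw [List.pairwise_cons] at hr
    by_cases hax : R a x
    · have hay : R a y := of_not_left hax hyx
      have haz := RowRelation.trans hax hxz
      simpa [pass, push, hax, hay, haz] using ih hr.2
    by_cases hay : R a y
    · have haz := RowRelation.trans hay hyz
      simp only [pass, push, hax, hay, haz, hxz, if_true, if_false, List.append_nil, true_and]
      rcases push_snd_eq (R := R) (push R r y).1 z with hd | ⟨d, hd⟩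
      · rw [hd]
        exact .refl _
      · obtain ⟨c, h₁, h₂, -⟩ := push_push_of_rel hr.2 hyz hd
        have hcy := (mem_push_snd (R := R) (r := r) (x := y) (c := c) (by simp [h₁])).2
        rw [h₁, hd]
        exact .swap_left (fun h => hcy (RowRelation.trans h hay)) h₂
    · simp only [pass, push, hay, hyx, hyz, hxz, if_true, if_false, List.append_nil, true_and]
      rcases push_snd_eq (R := R) r z with hd | ⟨d, hd⟩
      · rw [hd]
        exact .refl _
      · have hdr := (mem_push_snd (R := R) (r := r) (x := z) (c := d) (by simp [hd])).1
        rw [hd]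
        exact .swap_left hay (hr.1 d hdr)

/-- Equivalent words turn a row into the same row and replace equivalent words in it. -/
theorem PlacticEquiv.pass {r v w : List A} (h : PlacticEquiv R v w) (hr : r.Pairwise R) :
    (Plactic.pass R r v).1 = (Plactic.pass R r w).1 ∧
      PlacticEquiv R (Plactic.pass R r v).2 (Plactic.pass R r w).2 := by
  induction h generalizing r with
  | swap_right h₁ h₂ => exact pass_swap_right hr h₁ h₂
  | swap_left h₁ h₂ => exact pass_swap_left hr h₁ h₂
  | refl w => exact ⟨rfl, .refl _⟩
  | symm _ ih => exact ⟨(ih hr).1.symm, (ih hr).2.symm⟩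
  | trans _ _ ih₁ ih₂ => exact ⟨(ih₁ hr).1.trans (ih₂ hr).1, (ih₁ hr).2.trans (ih₂ hr).2⟩
  | append _ _ ih₁ ih₂ =>
    rw [pass_append, pass_append, (ih₁ hr).1]
    exact ⟨(ih₂ (sorted_pass _ hr)).1, (ih₁ hr).2.append (ih₂ (sorted_pass _ hr)).2⟩

/-! ### Row insertion realizes the plactic product -/

omit [DecidableRel R] in
/-- A letter that the first letter of a row may not precede moves through the rest of that row. -/
theorem cls_cons_concat {y x : A} {t : List A} (ht : (y :: t).Pairwise R) (h : ¬ R y x) :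
    cls R (y :: t ++ [x]) = cls R (y :: x :: t) := by
  induction t generalizing y with
  | nil => rfl
  | cons a t ih =>
    rw [List.pairwise_cons] at ht
    have hya : R y a := ht.1 a (by simp)
    have h₁ := ih ht.2 fun h' => h (RowRelation.trans hya h')
    have h₂ : cls R [y, a, x] = cls R [y, x, a] := cls_eq.2 (.symm (.swap_left h hya))
    calc cls R (y :: a :: t ++ [x]) = cls R [y] * cls R (a :: t ++ [x]) := rfl
      _ = cls R [y, a, x] * cls R t := by rw [h₁]; rfl
      _ = cls R (y :: x :: a :: t) := by rw [h₂]; rfl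

theorem cls_push {r : List A} (x : A) (hr : r.Pairwise R) :
    cls R (r ++ [x]) = cls R ((push R r x).2 ++ (push R r x).1) := by
  induction r with
  | nil => rfl
  | cons a r ih =>
    by_cases hax : R a x
    · have h₁ := ih (List.pairwise_cons.1 hr).2
      simp only [push, hax, if_true]
      rcases push_snd_eq (R := R) r x with hc | ⟨c, hc⟩
      · rw [hc] at h₁ ⊢
        rw [List.cons_append, cls_cons, h₁]
        rfl
      · have hcx := (mem_push_snd (R := R) (r := r) (x := x) (c := c) (by simp [hc])).2
        obtain ⟨e, s, hs, hae, hce⟩ : ∃ e s, (push R r x).1 = e :: s ∧ R a e ∧ ¬ R c e := by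
          cases r with
          | nil => exact ⟨x, [], rfl, hax, hcx⟩
          | cons b r =>
            by_cases hbx : R b x
            · refine ⟨b, (push R r x).1, by simp [push, hbx], ?_, fun h => ?_⟩
              · exact (List.pairwise_cons.1 hr).1 b (by simp)
              · exact hcx (RowRelation.trans h hbx)
            · exact ⟨x, r, by simp [push, hbx], hax, hcx⟩
        have h₂ : cls R [a, c, e] = cls R [c, a, e] := cls_eq.2 (.swap_right hae hce)
        rw [hc, hs] at h₁ ⊢
        calc cls R (a :: r ++ [x]) = cls R [a] * cls R (r ++ [x]) := rfl
          _ = cls R [a, c, e] * cls R s := by rw [h₁]; rfl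
          _ = cls R ([c] ++ (a :: e :: s)) := by rw [h₂]; rfl
    · simpa [push, hax] using cls_cons_concat hr hax

/-- Reading the letters replaced before the new row amounts to reading the old row before the
inserted word. -/
theorem cls_pass {r : List A} (w : List A) (hr : r.Pairwise R) :
    cls R (r ++ w) = cls R ((pass R r w).2 ++ (pass R r w).1) := by
  induction w generalizing r with
  | nil => simp
  | cons x w ih =>
    have h₁ := ih (sorted_push x hr)
    have h₂ := cls_push x hr
    rw [cls_append] at h₁ h₂ ⊢
    rw [cls_cons, ← mul_assoc, h₂, cls_append, mul_assoc, h₁]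
    simp only [pass, cls_append, mul_assoc]

/-! ### Passing rows through a row -/

omit [RowRelation R] in
theorem pass_cons_of_rel {a : A} {w : List A} (r : List A) (h : ∀ x ∈ w, R a x) :
    pass R (a :: r) w = (a :: (pass R r w).1, (pass R r w).2) := by
  induction w generalizing r with
  | nil => rfl
  | cons x w ih =>
    rw [List.forall_mem_cons] at h
    simp [pass, push, h.1, ih _ h.2]

theorem pass_cons_cons_of_rel {a x : A} {w : List A} (r : List A) (hw : (x :: w).Pairwise R)
    (h : R a x) : pass R (a :: r) (x :: w) =
      (a :: (pass R r (x :: w)).1, (pass R r (x :: w)).2) :=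
  pass_cons_of_rel r (List.forall_mem_cons.2
    ⟨h, fun e he => RowRelation.trans h ((List.pairwise_cons.1 hw).1 e he)⟩)

omit [RowRelation R] in
theorem pass_cons_cons_of_not {a x : A} {w : List A} (r : List A) (hw : (x :: w).Pairwise R)
    (h : ¬ R a x) : pass R (a :: r) (x :: w) =
      (x :: (pass R r w).1, a :: (pass R r w).2) := by
  simp [pass, push, h, pass_cons_of_rel _ (List.pairwise_cons.1 hw).1]

omit [RowRelation R] in
theorem pass_nil_left {w : List A} (hw : w.Pairwise R) : pass R [] w = (w, []) := by
  induction w with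
  | nil => rfl
  | cons x w ih =>
    rw [List.pairwise_cons] at hw
    simp [pass, push, pass_cons_of_rel _ hw.1, ih hw.2]

omit [RowRelation R] in
/-- A row `y` inserted into a row `z` above `y` replaces all of `z`. -/
theorem pass_of_above {y z : List A} (hy : y.Pairwise R) (h : Above R z y) :
    pass R z y = (y, z) := by
  induction z generalizing y with
  | nil => exact pass_nil_left hy
  | cons a z ih =>
    cases y with
    | nil => exact h.elim
    | cons b y => rw [pass_cons_cons_of_not z hy h.1, ih (List.pairwise_cons.1 hy).2 h.2]

theorem mem_of_mem_pass_snd {r w : List A} {c : A} (hw : w.Pairwise R)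
    (h : c ∈ (pass R r w).2) : c ∈ r := by
  induction r generalizing w with
  | nil => simp [pass_nil_left hw] at h
  | cons a r ih =>
    cases w with
    | nil => simp at h
    | cons x w =>
      by_cases hax : R a x
      · rw [pass_cons_cons_of_rel r hw hax] at h
        exact List.mem_cons_of_mem _ (ih hw h)
      · rw [pass_cons_cons_of_not r hw hax] at h
        rcases List.mem_cons.1 h with rfl | h
        · simp
        · exact List.mem_cons_of_mem _ (ih (List.pairwise_cons.1 hw).2 h)

theorem sorted_pass_snd {r w : List A} (hr : r.Pairwise R) (hw : w.Pairwise R) :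
    (pass R r w).2.Pairwise R := by
  induction r generalizing w with
  | nil => simp [pass_nil_left hw]
  | cons a r ih =>
    rw [List.pairwise_cons] at hr
    cases w with
    | nil => simp
    | cons x w =>
      by_cases hax : R a x
      · rw [pass_cons_cons_of_rel r hw hax]
        exact ih hr.2 hw
      · rw [pass_cons_cons_of_not r hw hax]
        have hw' := (List.pairwise_cons.1 hw).2
        exact List.pairwise_cons.2
          ⟨fun c hc => hr.1 c (mem_of_mem_pass_snd hw' hc), ih hr.2 hw'⟩

/-- If the first letter of a row is attached to the right end, then so are the others. -/
theorem pass_snd_eq_nil {r w : List A} {x : A} (hw : (x :: w).Pairwise R)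
    (h : (push R r x).2 = []) : (pass R r (x :: w)).2 = [] := by
  induction r with
  | nil => simp [pass_nil_left hw]
  | cons a r ih =>
    by_cases hax : R a x
    · rw [pass_cons_cons_of_rel r hw hax]
      exact ih (by simpa [push, hax] using h)
    · simp [push, hax] at h

omit [DecidableRel R] in
theorem Above.cons_right {a : A} {b s : List A} (h : Above R b s) (hs : (a :: s).Pairwise R) :
    Above R b (a :: s) := by
  induction b generalizing a s with
  | nil => simp
  | cons c b ih =>
    cases s with
    | nil => exact h.elim
    | cons d s =>
      rw [List.pairwise_cons] at hs
      exact ⟨fun hca => h.1 (RowRelation.trans hca (hs.1 d (by simp))), ih h.2 hs.2⟩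

/-- A row replaced by a row lies above the new row. -/
theorem above_pass {r w : List A} (hr : r.Pairwise R) (hw : w.Pairwise R) :
    Above R (pass R r w).2 (pass R r w).1 := by
  induction r generalizing w with
  | nil => simp [pass_nil_left hw]
  | cons a r ih =>
    cases w with
    | nil => simp
    | cons x w =>
      have hs := sorted_pass (R := R) (x :: w) hr
      rw [List.pairwise_cons] at hr
      by_cases hax : R a x
      · rw [pass_cons_cons_of_rel r hw hax] at hs ⊢
        exact (ih hr.2 hw).cons_right hs
      · rw [pass_cons_cons_of_not r hw hax]
        exact ⟨hax, ih hr.2 (List.pairwise_cons.1 hw).2⟩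

/-- If the row `z` lies above the row `y` and both are passed through a row, `z` before `y`, then
the row replaced by `z` lies above the row replaced by `y`. -/
theorem above_pass_pass {r y z : List A} (hr : r.Pairwise R) (hy : y.Pairwise R)
    (hz : z.Pairwise R) (h : Above R z y) :
    Above R (pass R r z).2 (pass R (pass R r z).1 y).2 := by
  induction hn : r.length generalizing r y z with
  | zero => simp [List.length_eq_zero_iff.1 hn, pass_nil_left hz]
  | succ n ih =>
    obtain ⟨a, r, rfl⟩ := List.exists_cons_of_length_eq_add_one hn
    have hr' := List.pairwise_cons.1 hr
    have hn' : r.length = n := by simpa using hn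
    match z, y, h with
    | [], _, _ => simp
    | z₁ :: z, y₁ :: y, h =>
      have hz' := List.pairwise_cons.1 hz
      have hy' := List.pairwise_cons.1 hy
      by_cases haz : R a z₁
      · rw [pass_cons_cons_of_rel r hz haz]
        by_cases hay : R a y₁
        · rw [pass_cons_cons_of_rel _ hy hay]
          exact ih hr'.2 hy hz h hn'
        · rw [pass_cons_cons_of_not _ hy hay]
          -- The letter `y₁` replaces `a`, so the rest of `y` is to be compared with the rest of
          -- `z`, passed through the row `r` into which `z₁` has already been inserted.
          rcases push_snd_eq (R := R) r z₁ with hc | ⟨c, hc⟩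
          · simp [pass_snd_eq_nil hz hc]
          · have hcz := (mem_push_snd (R := R) (r := r) (x := z₁) (c := c) (by simp [hc])).2
            simp only [pass, hc]
            exact ⟨fun h => hcz (RowRelation.trans h haz),
              ih (sorted_push z₁ hr'.2) hy'.2 hz'.2 h.2 ((length_push_of_snd hc).trans hn')⟩
      · rw [pass_cons_cons_of_not r hz haz, pass_cons_cons_of_not _ hy h.1]
        exact ⟨haz, ih hr'.2 hy'.2 hz'.2 h.2 hn'⟩

end Rows

/-! ### Stacks of rows -/

/-- A stack of `R`-rows, listed from bottom to top: each row lies above the previous one. The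
upper rows may be empty; a decorated tableau `(T, α)` is encoded by the stack of the rows of `T`
with `α` empty rows on top. -/
def IsStack {A : Type*} (R : A → A → Prop) (s : List (List A)) : Prop :=
  (∀ r ∈ s, r.Pairwise R) ∧ s.IsChain (fun a b => Above R b a)

/-- The reading of a stack: rows from top to bottom, each from left to right. -/
def reading {A : Type*} (s : List (List A)) : List A := s.reverse.flatten

/-- The stack obtained by inserting a word into a stack with a fixed number of rows; the letters
replaced in the top row are discarded. -/
def absorb {A : Type*} (R : A → A → Prop) [DecidableRel R] : List (List A) → List A → List (List A)
  | [], _ => []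
  | r :: s, w => (pass R r w).1 :: absorb R s (pass R r w).2

/-- The rows of the stack `t` are passed through the row `r`, the top row of `t` first. The second
component is the stack of the rows replaced. -/
def passRow {A : Type*} (R : A → A → Prop) [DecidableRel R] :
    List A → List (List A) → List A × List (List A)
  | r, [] => (r, [])
  | r, y :: t => ((pass R (passRow R r t).1 y).1,
      (pass R (passRow R r t).1 y).2 :: (passRow R r t).2)

/-- The stack `t` is passed through the stack `s`. Both components keep their numbers of rows,
and the second one put on top of the first one is the product of `s` and `t`. -/
def passRows {A : Type*} (R : A → A → Prop) [DecidableRel R] :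
    List (List A) → List (List A) → List (List A) × List (List A)
  | [], t => ([], t)
  | r :: s, t => ((passRow R r t).1 :: (passRows R s (passRow R r t).2).1,
      (passRows R s (passRow R r t).2).2)

section

variable {A : Type*} {R : A → A → Prop}

theorem isStack_nil : IsStack R [] := by simp [IsStack]

theorem isStack_cons {y : List A} {s : List (List A)} :
    IsStack R (y :: s) ↔ y.Pairwise R ∧ (∀ z ∈ s.head?, Above R z y) ∧ IsStack R s := by
  simp only [IsStack, List.isChain_cons, List.forall_mem_cons]
  tauto

theorem IsStack.tail {y : List A} {s : List (List A)} (h : IsStack R (y :: s)) : IsStack R s :=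
  (isStack_cons.1 h).2.2

theorem isStack_append {s t : List (List A)} : IsStack R (s ++ t) ↔
    IsStack R s ∧ IsStack R t ∧ ∀ y ∈ s.getLast?, ∀ z ∈ t.head?, Above R z y := by
  simp only [IsStack, List.isChain_append, List.forall_mem_append]
  tauto

theorem isStack_replicate_nil (n : ℕ) : IsStack R (List.replicate n []) := by
  induction n with
  | zero => exact isStack_nil
  | succ n ih =>
    rw [List.replicate_succ, isStack_cons]
    refine ⟨by simp, fun z hz => ?_, ih⟩
    rw [(List.mem_replicate.1 (List.mem_of_mem_head? hz)).2]
    exact above_nil _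

/-- Empty rows may be put on top of a stack. -/
theorem IsStack.append_replicate {s : List (List A)} (h : IsStack R s) (n : ℕ) :
    IsStack R (s ++ List.replicate n []) := by
  refine isStack_append.2 ⟨h, isStack_replicate_nil n, fun y _ z hz => ?_⟩
  rw [(List.mem_replicate.1 (List.mem_of_mem_head? hz)).2]
  exact above_nil _

@[simp] theorem reading_nil : reading ([] : List (List A)) = [] := rfl

theorem reading_cons (y : List A) (s : List (List A)) : reading (y :: s) = reading s ++ y := by
  simp [reading]

theorem reading_append (s t : List (List A)) : reading (s ++ t) = reading t ++ reading s := by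
  simp [reading]

@[simp] theorem reading_replicate_nil (n : ℕ) :
    reading (List.replicate n ([] : List A)) = [] := by
  simp [reading]

variable [DecidableRel R]

/-! ### A stack is determined by its number of rows and the class of its reading -/

@[simp] theorem absorb_nil_right (s : List (List A)) : absorb R s [] = s := by
  induction s with
  | nil => rfl
  | cons r s ih => simp [absorb, ih]

theorem absorb_append (s : List (List A)) (v w : List A) :
    absorb R s (v ++ w) = absorb R (absorb R s v) w := by
  induction s generalizing v w with
  | nil => rfl
  | cons r s ih => simp [absorb, pass_append, ih]

@[simp] theorem length_passRow_snd (r : List A) (t : List (List A)) :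
    (passRow R r t).2.length = t.length := by
  induction t with
  | nil => rfl
  | cons y t ih => simp [passRow, ih]

@[simp] theorem length_passRows_fst (s t : List (List A)) :
    (passRows R s t).1.length = s.length := by
  induction s generalizing t with
  | nil => rfl
  | cons r s ih => simp [passRows, ih]

@[simp] theorem length_passRows_snd (s t : List (List A)) :
    (passRows R s t).2.length = t.length := by
  induction s generalizing t with
  | nil => rfl
  | cons r s ih => simp [passRows, ih]

@[simp] theorem passRows_nil_right (s : List (List A)) : passRows R s [] = (s, []) := by
  induction s with
  | nil => rfl
  | cons r s ih => simp [passRows, passRow, ih]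

theorem passRows_append_left (s s' t : List (List A)) : passRows R (s ++ s') t =
    ((passRows R s t).1 ++ (passRows R s' (passRows R s t).2).1,
      (passRows R s' (passRows R s t).2).2) := by
  induction s generalizing t with
  | nil => rfl
  | cons r s ih => simp [passRows, ih]

theorem passRow_append (r : List A) (t t' : List (List A)) : passRow R r (t ++ t') =
    ((passRow R (passRow R r t').1 t).1,
      (passRow R (passRow R r t').1 t).2 ++ (passRow R r t').2) := by
  induction t with
  | nil => rfl
  | cons y t ih => simp [passRow, ih]

theorem passRows_append_right (s t t' : List (List A)) : passRows R s (t ++ t') =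
    ((passRows R (passRows R s t').1 t).1,
      (passRows R (passRows R s t').1 t).2 ++ (passRows R s t').2) := by
  induction s generalizing t t' with
  | nil => rfl
  | cons r s ih => simp [passRows, passRow_append, ih]

variable [RowRelation R]

theorem absorb_congr {s : List (List A)} {v w : List A} (hs : ∀ r ∈ s, r.Pairwise R)
    (h : PlacticEquiv R v w) : absorb R s v = absorb R s w := by
  induction s generalizing v w with
  | nil => rfl
  | cons r s ih =>
    rw [List.forall_mem_cons] at hs
    rw [absorb, absorb, (h.pass hs.1).1, ih hs.2 (h.pass hs.1).2]

omit [RowRelation R] in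
theorem absorb_row {t : List (List A)} {y : List A} (h : IsStack R (y :: t)) (k : ℕ) :
    absorb R (t ++ List.replicate (k + 1) []) y = y :: t ++ List.replicate k [] := by
  induction t generalizing y with
  | nil => simp [List.replicate_succ, absorb, pass_nil_left (isStack_cons.1 h).1]
  | cons z t ih =>
    have h' := isStack_cons.1 h
    rw [List.cons_append, absorb, pass_of_above h'.1 (h'.2.1 z (by simp)), ih h.tail]
    rfl

omit [RowRelation R] in
/-- Inserting the reading of a stack into empty rows yields the stack. -/
theorem absorb_reading {s : List (List A)} (hs : IsStack R s) (k : ℕ) :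
    absorb R (List.replicate (s.length + k) []) (reading s) = s ++ List.replicate k [] := by
  induction s generalizing k with
  | nil => simp
  | cons y s ih =>
    have := ih hs.tail (k + 1)
    rw [← add_assoc] at this
    rw [reading_cons, absorb_append, List.length_cons, Nat.add_right_comm, this, absorb_row hs]

theorem IsStack.eq_of_cls_eq {s t : List (List A)} (hs : IsStack R s) (ht : IsStack R t)
    (hl : s.length = t.length) (h : cls R (reading s) = cls R (reading t)) : s = t := by
  have h₁ := absorb_reading hs 0
  have h₂ := absorb_reading ht 0
  rw [← hl, ← absorb_congr (by simp) (cls_eq.1 h)] at h₂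
  simpa using h₁.symm.trans h₂

/-- Among the stacks with plactic equivalent readings, one without empty rows has the least
number of rows. -/
theorem IsStack.length_le {s t : List (List A)} (hs : IsStack R s) (ht : IsStack R t)
    (hne : ∀ r ∈ s, r ≠ []) (h : cls R (reading s) = cls R (reading t)) :
    s.length ≤ t.length := by
  by_contra! hlt
  have hst : s = t ++ List.replicate (s.length - t.length) [] := by
    refine hs.eq_of_cls_eq (ht.append_replicate _) ?_ ?_
    · simp; omega
    · simpa [reading_append] using h
  refine hne [] ?_ rfl
  rw [hst]
  simp; omega

/-! ### Passing stacks through stacks -/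

theorem sorted_passRow {r : List A} (t : List (List A)) (hr : r.Pairwise R) :
    (passRow R r t).1.Pairwise R := by
  induction t with
  | nil => exact hr
  | cons y t ih => exact sorted_pass _ ih

/-- The rows replaced in the row `r` by those of a stack form a stack on top of the new row. -/
theorem isStack_passRow {r : List A} {t : List (List A)} (hr : r.Pairwise R) (ht : IsStack R t) :
    IsStack R ((passRow R r t).1 :: (passRow R r t).2) := by
  induction t with
  | nil => exact isStack_cons.2 ⟨hr, by simp [passRow], isStack_nil⟩
  | cons y t ih =>
    have hy := isStack_cons.1 ht
    have h₁ := isStack_cons.1 (ih ht.tail)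
    refine isStack_cons.2 ⟨sorted_pass _ h₁.1, ?_, isStack_cons.2
      ⟨sorted_pass_snd h₁.1 hy.1, ?_, h₁.2.2⟩⟩
    · rintro _ ⟨⟩
      exact above_pass h₁.1 hy.1
    · cases t with
      | nil => simp [passRow]
      | cons z t =>
        have hz := isStack_cons.1 ht.tail
        have h₂ : (passRow R r t).1.Pairwise R := sorted_passRow t hr
        rintro _ ⟨⟩
        exact above_pass_pass h₂ hy.1 hz.1 (hy.2.1 z (by simp))

theorem above_push_right {q r : List A} (x : A) (h : Above R q r) : Above R q (push R r x).1 := by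
  induction r generalizing q with
  | nil => cases q with
    | nil => simp
    | cons b q => exact h.elim
  | cons a r ih =>
    cases q with
    | nil => simp
    | cons b q =>
      by_cases hax : R a x
      · simpa [push, hax] using above_cons.2 ⟨h.1, ih h.2⟩
      · simp only [push, hax, if_false]
        exact ⟨fun hbx => h.1 (of_not_left hbx hax), h.2⟩

theorem above_push_push {q r : List A} {x c : A} (h : Above R q r) (hc : (push R r x).2 = [c]) :
    Above R (push R q c).1 (push R r x).1 := by
  induction r generalizing q with
  | nil => simp [push] at hc
  | cons a r ih =>
    by_cases hax : R a x
    · simp only [push, hax, if_true] at hc ⊢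
      have hcx := (mem_push_snd (R := R) (r := r) (x := x) (c := c) (by simp [hc])).2
      have hca : ¬ R c a := fun h => hcx (RowRelation.trans h hax)
      cases q with
      | nil => exact ⟨hca, above_nil _⟩
      | cons b q =>
        by_cases hbc : R b c
        · simpa [push, hbc] using above_cons.2 ⟨h.1, ih h.2 hc⟩
        · simpa [push, hbc] using above_cons.2 ⟨hca, above_push_right x h.2⟩
    · simp only [push, hax, if_false] at hc ⊢
      obtain rfl : a = c := by simpa using hc
      cases q with
      | nil => exact ⟨hax, above_nil _⟩
      | cons b q => simpa [push, h.1] using above_cons.2 ⟨hax, h.2⟩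

/-- Passing a word through a row `r`, and the letters replaced there through a row `q` above `r`,
keeps `q` above `r`. -/
theorem above_pass_pass_snd {q r : List A} (w : List A) (h : Above R q r) :
    Above R (pass R q (pass R r w).2).1 (pass R r w).1 := by
  induction w generalizing q r with
  | nil => exact h
  | cons x w ih =>
    simp only [pass, pass_append]
    refine ih ?_
    rcases push_snd_eq (R := R) r x with hc | ⟨c, hc⟩
    · simpa [hc] using above_push_right x h
    · simpa [hc, pass] using above_push_push h hc

theorem above_passRow_passRow {q r : List A} (t : List (List A)) (h : Above R q r) :
    Above R (passRow R q (passRow R r t).2).1 (passRow R r t).1 := by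
  induction t with
  | nil => exact h
  | cons y t ih => exact above_pass_pass_snd y ih

/-- The product of two stacks, i.e. what becomes of `t` on top of what becomes of `s`, is a
stack. -/
theorem isStack_passRows {s t : List (List A)} (hs : IsStack R s) (ht : IsStack R t) :
    IsStack R ((passRows R s t).1 ++ (passRows R s t).2) := by
  induction s generalizing t with
  | nil => exact ht
  | cons r s ih =>
    have hr := isStack_cons.1 hs
    have h₁ := isStack_cons.1 (isStack_passRow hr.1 ht)
    refine isStack_cons.2 ⟨h₁.1, ?_, ih hs.tail h₁.2.2⟩
    cases s with
    | nil => simpa [passRows] using h₁.2.1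
    | cons q s =>
      rintro _ ⟨⟩
      exact above_passRow_passRow t (hr.2.1 q (by simp))

theorem cls_passRow {r : List A} {t : List (List A)} (hr : r.Pairwise R) (ht : IsStack R t) :
    cls R (r ++ reading t) = cls R (reading (passRow R r t).2 ++ (passRow R r t).1) := by
  induction t with
  | nil => simp [passRow]
  | cons y t ih =>
    have h₁ := cls_pass y (isStack_cons.1 (isStack_passRow hr ht.tail)).1
    have h₂ := ih ht.tail
    simp only [passRow, reading_cons, cls_append] at h₁ h₂ ⊢
    rw [← mul_assoc, h₂, mul_assoc, h₁, mul_assoc]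

theorem cls_passRows {s t : List (List A)} (hs : IsStack R s) (ht : IsStack R t) :
    cls R (reading ((passRows R s t).1 ++ (passRows R s t).2)) =
      cls R (reading s) * cls R (reading t) := by
  induction s generalizing t with
  | nil => simp [passRows, cls_nil]
  | cons r s ih =>
    have hr := isStack_cons.1 hs
    have h₁ := cls_passRow hr.1 ht
    have h₂ := ih hs.tail (isStack_cons.1 (isStack_passRow hr.1 ht)).2.2
    simp only [passRows, List.cons_append, reading_cons, cls_append] at h₁ h₂ ⊢
    rw [h₂, mul_assoc, ← h₁, mul_assoc]

/-- The stacks `b` and `a` obtained by passing `t` through `s` are characterized by their numbers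
of rows and the fact that `a` on top of `b` is a stack representing the plactic product. -/
theorem passRows_eq {s t a b : List (List A)} (hs : IsStack R s) (ht : IsStack R t)
    (hba : IsStack R (b ++ a)) (hb : b.length = s.length) (ha : a.length = t.length)
    (h : cls R (reading (b ++ a)) = cls R (reading s) * cls R (reading t)) :
    passRows R s t = (b, a) := by
  have := (isStack_passRows hs ht).eq_of_cls_eq hba (by simp [ha, hb])
    ((cls_passRows hs ht).trans h.symm)
  exact Prod.ext (List.append_inj_left this (by simp [hb]))
    (List.append_inj_right this (by simp [hb]))

end

/-! ### The braided commutative monoid of stacks -/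

/-- The stacks of `R`-rows. -/
abbrev Stack {A : Type*} (R : A → A → Prop) := {s : List (List A) // IsStack R s}

section

variable {A : Type*} {R : A → A → Prop} [DecidableRel R] [RowRelation R]

/-- The product of two stacks. -/
def stackMul (u v : Stack R) : Stack R :=
  ⟨(passRows R u.1 v.1).1 ++ (passRows R u.1 v.1).2, isStack_passRows u.2 v.2⟩

/-- The braiding of two stacks `u` and `v` cuts their product into its bottom part with as many
rows as `u`, and its top part with as many rows as `v`. -/
def stackBraid (p : Stack R × Stack R) : Stack R × Stack R :=
  (⟨(passRows R p.1.1 p.2.1).2, (isStack_append.1 (isStack_passRows p.1.2 p.2.2)).2.1⟩,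
    ⟨(passRows R p.1.1 p.2.1).1, (isStack_append.1 (isStack_passRows p.1.2 p.2.2)).1⟩)

@[simp] theorem length_stackMul (u v : Stack R) :
    (stackMul u v).1.length = u.1.length + v.1.length := by
  simp [stackMul]

theorem cls_stackMul (u v : Stack R) : cls R (reading (stackMul u v).1) =
    cls R (reading u.1) * cls R (reading v.1) :=
  cls_passRows u.2 v.2

theorem stack_ext {u v : Stack R} (hl : u.1.length = v.1.length)
    (h : cls R (reading u.1) = cls R (reading v.1)) : u = v :=
  Subtype.ext (u.2.eq_of_cls_eq v.2 hl h)

theorem stackBraid_eq_iff {u v a b : Stack R} :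
    stackBraid (u, v) = (a, b) ↔ passRows R u.1 v.1 = (b.1, a.1) := by
  simp only [stackBraid, Prod.ext_iff, Subtype.ext_iff]
  exact and_comm

/-- The value of the braiding is the factorization of the product with prescribed numbers of rows
whose factors form a stack. -/
theorem stackBraid_eq_iff_append {u v a b : Stack R} : stackBraid (u, v) = (a, b) ↔
    b.1 ++ a.1 = (stackMul u v).1 ∧ b.1.length = u.1.length ∧ a.1.length = v.1.length := by
  rw [stackBraid_eq_iff]
  constructor
  · intro h
    have h₁ := length_passRows_fst (R := R) u.1 v.1
    have h₂ := length_passRows_snd (R := R) u.1 v.1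
    rw [h] at h₁ h₂
    exact ⟨by simp [stackMul, h], h₁, h₂⟩
  · rintro ⟨h, h₁, h₂⟩
    refine passRows_eq u.2 v.2 (h ▸ (stackMul u v).2) h₁ h₂ ?_
    rw [h, cls_stackMul]

theorem stackBraid_eq {u v a b : Stack R} (hba : IsStack R (b.1 ++ a.1))
    (hb : b.1.length = u.1.length) (ha : a.1.length = v.1.length)
    (h : cls R (reading a.1) * cls R (reading b.1) = cls R (reading u.1) * cls R (reading v.1)) :
    stackBraid (u, v) = (a, b) :=
  stackBraid_eq_iff.2 (passRows_eq u.2 v.2 hba hb ha (by rwa [reading_append, cls_append]))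

theorem stackBraid_spec {u v a b : Stack R} (h : stackBraid (u, v) = (a, b)) :
    IsStack R (b.1 ++ a.1) ∧ b.1.length = u.1.length ∧ a.1.length = v.1.length ∧
      cls R (reading a.1) * cls R (reading b.1) = cls R (reading u.1) * cls R (reading v.1) := by
  obtain ⟨h₁, h₂, h₃⟩ := stackBraid_eq_iff_append.1 h
  refine ⟨h₁ ▸ (stackMul u v).2, h₂, h₃, ?_⟩
  rw [← cls_append, ← reading_append, h₁, cls_stackMul]

/-- Pass the stack `b ++ a` through `c`: its upper part `a` is passed first, and its lower part
`b` is passed through what `c` has become. -/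
theorem isStack_of_stackBraid_left {a b c d e : Stack R} (h : IsStack R (b.1 ++ a.1))
    (hde : stackBraid (c, a) = (d, e)) : IsStack R ((stackMul e b).1 ++ d.1) := by
  have := isStack_passRows c.2 h
  rw [passRows_append_right, stackBraid_eq_iff.1 hde] at this
  simpa [stackMul] using this

/-- Pass `c` through the stack `b ++ a`: first through its lower part `b`, and what is replaced
there through its upper part `a`. -/
theorem isStack_of_stackBraid_right {a b c d e : Stack R} (h : IsStack R (b.1 ++ a.1))
    (hde : stackBraid (b, c) = (d, e)) : IsStack R (e.1 ++ (stackMul a d).1) := by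
  have := isStack_passRows h c.2
  rw [passRows_append_left, stackBraid_eq_iff.1 hde] at this
  simpa [stackMul] using this

/-- Both sides of the Yang–Baxter equation cut the product of three stacks into three pieces with
prescribed numbers of rows. -/
theorem isBraiding_stackBraid : IsBraiding (stackBraid (R := R)) := by
  rintro ⟨u, v, w⟩
  obtain ⟨⟨v₁, u₁⟩, h₁⟩ : ∃ p, stackBraid (u, v) = p := ⟨_, rfl⟩
  obtain ⟨⟨w₁, u₂⟩, h₂⟩ : ∃ p, stackBraid (u₁, w) = p := ⟨_, rfl⟩
  obtain ⟨⟨w₂, v₂⟩, h₃⟩ : ∃ p, stackBraid (v₁, w₁) = p := ⟨_, rfl⟩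
  obtain ⟨⟨w₁', v₁'⟩, k₁⟩ : ∃ p, stackBraid (v, w) = p := ⟨_, rfl⟩
  obtain ⟨⟨w₂', u₁'⟩, k₂⟩ : ∃ p, stackBraid (u, w₁') = p := ⟨_, rfl⟩
  obtain ⟨⟨v₂', u₂'⟩, k₃⟩ : ∃ p, stackBraid (u₁', v₁') = p := ⟨_, rfl⟩
  simp only [onFirstTwo, onLastTwo, h₁, h₂, h₃, k₁, k₂, k₃]
  obtain ⟨s₁, l₁, m₁, c₁⟩ := stackBraid_spec h₁
  obtain ⟨-, l₂, m₂, c₂⟩ := stackBraid_spec h₂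
  obtain ⟨-, l₃, m₃, c₃⟩ := stackBraid_spec h₃
  obtain ⟨t₁, l₁', m₁', c₁'⟩ := stackBraid_spec k₁
  obtain ⟨-, l₂', m₂', c₂'⟩ := stackBraid_spec k₂
  obtain ⟨-, l₃', m₃', c₃'⟩ := stackBraid_spec k₃
  have hs : IsStack R (u₂.1 ++ (v₂.1 ++ w₂.1)) := by
    rw [(stackBraid_eq_iff_append.1 h₃).1]
    exact isStack_of_stackBraid_right s₁ h₂
  have ht : IsStack R (u₂'.1 ++ (v₂'.1 ++ w₂'.1)) := by
    rw [← List.append_assoc, (stackBraid_eq_iff_append.1 k₃).1]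
    exact isStack_of_stackBraid_left t₁ k₂
  have heq : u₂.1 ++ (v₂.1 ++ w₂.1) = u₂'.1 ++ (v₂'.1 ++ w₂'.1) := by
    refine hs.eq_of_cls_eq ht (by simp; omega) ?_
    simp only [reading_append, cls_append]
    rw [c₃, mul_assoc, c₂, ← mul_assoc, c₁, mul_assoc _ _ (cls R (reading u₂'.1)), c₃',
      ← mul_assoc, c₂', mul_assoc, mul_assoc, c₁']
  have hu : u₂.1.length = u₂'.1.length := by omega
  have hv : v₂.1.length = v₂'.1.length := by omega
  have h' := List.append_inj_right heq hu
  refine Prod.ext (Subtype.ext ?_) (Prod.ext (Subtype.ext ?_) (Subtype.ext ?_))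
  · exact List.append_inj_right h' hv
  · exact List.append_inj_left h' hv
  · exact List.append_inj_left heq hu

theorem isBraidedCommMonoid_stack :
    IsBraidedCommMonoid (stackMul (R := R)) ⟨[], isStack_nil⟩ stackBraid where
  mul_assoc u v w := stack_ext (by simp [add_assoc]) (by simp [cls_stackMul, mul_assoc])
  one_mul u := stack_ext (by simp) (by simp [cls_stackMul, cls_nil])
  mul_one u := stack_ext (by simp) (by simp [cls_stackMul, cls_nil])
  braiding := isBraiding_stackBraid
  braid_mul_left u v w w' v' w'' u' h₁ h₂ := by
    obtain ⟨s₁, l₁, m₁, c₁⟩ := stackBraid_spec h₁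
    obtain ⟨-, l₂, m₂, c₂⟩ := stackBraid_spec h₂
    refine stackBraid_eq (isStack_of_stackBraid_left s₁ h₂) (by simp; omega) (by omega) ?_
    rw [cls_stackMul, cls_stackMul, ← mul_assoc, c₂, mul_assoc, c₁, mul_assoc]
  braid_mul_right u v w v' u' w' u'' h₁ h₂ := by
    obtain ⟨s₁, l₁, m₁, c₁⟩ := stackBraid_spec h₁
    obtain ⟨-, l₂, m₂, c₂⟩ := stackBraid_spec h₂
    refine stackBraid_eq (isStack_of_stackBraid_right s₁ h₂) (by omega) (by simp; omega) ?_
    rw [cls_stackMul, cls_stackMul, mul_assoc, c₂, ← mul_assoc, c₁, mul_assoc]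
  braided_comm v w w' v' h := by
    obtain ⟨-, l, m, c⟩ := stackBraid_spec h
    exact stack_ext (by simp; omega) (by rw [cls_stackMul, cls_stackMul, c])
  braid_one_left w := stackBraid_eq_iff.2 rfl
  braid_one_right v := stackBraid_eq_iff.2 (passRows_nil_right _)

end

/-! ### Tableaux in the plactic monoid -/

section

variable {A : Type*} [LinearOrder A]

theorem rowGT_iff_above {x y : List A} : RowGT x y ↔ Above (fun a b : A => a ≤ b) x y := by
  induction x generalizing y with
  | nil => simp [rowGT_nil]
  | cons a x ih =>
    cases y with
    | nil => exact iff_of_false not_rowGT_cons_nil id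
    | cons b y => rw [rowGT_cons, above_cons, ih, not_le]

theorem RowGT.trans {x y z : List A} (h₁ : RowGT x y) (h₂ : RowGT y z) : RowGT x z :=
  ⟨h₁.1.trans h₂.1, fun i hx hz => (h₂.2 i (hx.trans_le h₁.1) hz).trans (h₁.2 i hx _)⟩

theorem RowGT.tail {x y : List A} (h : RowGT x y) : RowGT x.tail y.tail := by
  cases x with
  | nil => exact rowGT_nil _
  | cons a x =>
    cases y with
    | nil => exact (not_rowGT_cons_nil h).elim
    | cons b y => exact (rowGT_cons.1 h).2

theorem rowInsert_eq_push (r : List A) (x : A) :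
    (rowInsert r x).1 = (push (fun a b : A => a ≤ b) r x).1 ∧
      (rowInsert r x).2.toList = (push (fun a b : A => a ≤ b) r x).2 := by
  induction r with
  | nil => simp [rowInsert, push]
  | cons y r ih =>
    by_cases h : x < y
    · simp [rowInsert, push, h, not_le.2 h]
    · simp [rowInsert, push, h, not_lt.1 h, ih]

theorem cls_insertRows {s : List (List A)} (x : A) (hs : ∀ r ∈ s, r.Pairwise (· ≤ ·)) :
    cls (fun a b : A => a ≤ b) (reading (insertRows s x)) =
      cls (fun a b : A => a ≤ b) (reading s) * cls (fun a b : A => a ≤ b) [x] := by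
  induction s generalizing x with
  | nil => rfl
  | cons r s ih =>
    rw [List.forall_mem_cons] at hs
    have h := cls_push x hs.1
    rw [← (rowInsert_eq_push r x).1, ← (rowInsert_eq_push r x).2, cls_append] at h
    simp only [insertRows]
    split <;> rename_i hy
    · rw [reading_cons, reading_cons, cls_append, cls_append, mul_assoc, h, hy]
      rfl
    · rw [reading_cons, reading_cons, cls_append, cls_append, ih _ hs.2, mul_assoc, mul_assoc, h,
        hy]
      rfl

namespace Tableau

theorem length_rows (T : Tableau A) : T.rows.length = T.numRows := rfl

theorem reading_reverse_rows (T : Tableau A) : reading T.rows.reverse = T.rowReading := by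
  simp [reading, rowReading]

theorem cls_insertWord (T : Tableau A) (w : List A) :
    cls (fun a b : A => a ≤ b) (T.insertWord w).rowReading =
      cls (fun a b : A => a ≤ b) T.rowReading * cls (fun a b : A => a ≤ b) w := by
  induction w generalizing T with
  | nil => simp [insertWord, cls_nil]
  | cons x w ih =>
    have h : cls (fun a b : A => a ≤ b) (T.insert x).rowReading =
        cls (fun a b : A => a ≤ b) T.rowReading * cls (fun a b : A => a ≤ b) [x] := by
      rw [← reading_reverse_rows, ← reading_reverse_rows, insert, List.reverse_reverse]
      exact cls_insertRows x fun r hr => T.row_sorted r (List.mem_reverse.1 hr)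
    exact (ih (T.insert x)).trans (by rw [h, cls_cons x w, mul_assoc])

theorem cls_star (T T' : Tableau A) : cls (fun a b : A => a ≤ b) (T.star T').rowReading =
    cls (fun a b : A => a ≤ b) T.rowReading * cls (fun a b : A => a ≤ b) T'.rowReading :=
  cls_insertWord T _

theorem isStack_rows (T : Tableau A) : IsStack (fun a b : A => a ≤ b) T.rows.reverse := by
  refine ⟨fun r hr => T.row_sorted r (List.mem_reverse.1 hr), List.isChain_reverse.2 ?_⟩
  simpa only [← rowGT_iff_above] using T.decreasing

theorem reverse_rows_ne_nil (T : Tableau A) : ∀ r ∈ T.rows.reverse, r ≠ [] :=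
  fun r hr => T.ne_nil r (List.mem_reverse.1 hr)

/-- A tableau is determined by the plactic class of its row reading. -/
theorem eq_of_cls_eq {T T' : Tableau A} (h : cls (fun a b : A => a ≤ b) T.rowReading =
    cls (fun a b : A => a ≤ b) T'.rowReading) : T = T' := by
  rw [← reading_reverse_rows, ← reading_reverse_rows] at h
  have hl := (T.isStack_rows.length_le T'.isStack_rows T.reverse_rows_ne_nil h).antisymm
    (T'.isStack_rows.length_le T.isStack_rows T'.reverse_rows_ne_nil h.symm)
  exact Tableau.ext (List.reverse_injective (T.isStack_rows.eq_of_cls_eq T'.isStack_rows hl h))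

theorem pairwise_rows (T : Tableau A) : T.rows.Pairwise RowGT :=
  have : IsTrans (List A) RowGT := ⟨fun _ _ _ => RowGT.trans⟩
  List.isChain_iff_pairwise.1 T.decreasing

theorem length_le_numCols (T : Tableau A) : ∀ r ∈ T.rows, r.length ≤ T.numCols := by
  have h := T.pairwise_rows
  unfold numCols
  rcases List.eq_nil_or_concat T.rows with h' | ⟨l, b, h'⟩
  · simp [h']
  · rw [h', List.concat_eq_append] at h ⊢
    intro r hr
    rcases List.mem_append.1 hr with hr | hr
    · simpa using ((List.pairwise_append.1 h).2.2 r hr b (by simp)).1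
    · simp [List.mem_singleton.1 hr]

end Tableau

/-! ### Columns of a tableau -/

theorem pairwise_column {rows : List (List A)} (h : rows.Pairwise RowGT) (j : ℕ) :
    (rows.filterMap fun r => r[j]?).Pairwise (· > ·) := by
  refine h.filterMap _ fun r s hrs a ha b hb => ?_
  obtain ⟨hr, rfl⟩ := List.getElem?_eq_some_iff.1 ha
  obtain ⟨hs, rfl⟩ := List.getElem?_eq_some_iff.1 hb
  exact hrs.2 j hr hs

/-- A hook consisting of a row and a column with common corner `h` may be read along the row or
along the column first. -/
theorem cls_hook {h : A} {t c : List A} (ht : (h :: t).Pairwise (· ≤ ·))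
    (hc : (h :: c).Pairwise (· > ·)) :
    cls (fun a b : A => a ≤ b) (h :: t ++ c) = cls (fun a b : A => a ≤ b) (h :: c ++ t) := by
  induction c generalizing h with
  | nil => simp
  | cons x c ih =>
    have hc' := List.pairwise_cons.1 hc
    have ht' := List.pairwise_cons.1 ht
    have hxh : x < h := hc'.1 x (by simp)
    have h₁ := cls_cons_concat (R := fun a b : A => a ≤ b) ht (not_le.2 hxh)
    have h₂ := ih (List.pairwise_cons.2 ⟨fun e he => hxh.le.trans (ht'.1 e he), ht'.2⟩) hc'.2
    calc cls (fun a b : A => a ≤ b) (h :: t ++ x :: c)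
        = cls (fun a b : A => a ≤ b) (h :: t ++ [x]) * cls (fun a b : A => a ≤ b) c := by
          rw [← cls_append]; simp
      _ = cls (fun a b : A => a ≤ b) [h] * cls (fun a b : A => a ≤ b) (x :: t ++ c) := by
          rw [h₁]; rfl
      _ = cls (fun a b : A => a ≤ b) (h :: x :: c ++ t) := by rw [h₂]; rfl

theorem cls_flatten_eq_first_column {rows : List (List A)}
    (hs : ∀ r ∈ rows, r.Pairwise (· ≤ ·)) (h : rows.Pairwise RowGT) :
    cls (fun a b : A => a ≤ b) rows.flatten =
      cls (fun a b : A => a ≤ b) (rows.filterMap fun r => r[0]?) *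
        cls (fun a b : A => a ≤ b) (rows.map List.tail).flatten := by
  induction rows with
  | nil => rfl
  | cons r rows ih =>
    have hcol := pairwise_column h 0
    rw [List.forall_mem_cons] at hs
    have ih' := ih hs.2 (List.pairwise_cons.1 h).2
    cases r with
    | nil => simpa using ih'
    | cons a t =>
      have h₁ := cls_hook (c := rows.filterMap fun r => r[0]?) hs.1 hcol
      calc cls (fun a b : A => a ≤ b) ((a :: t) ++ rows.flatten)
          = cls (fun a b : A => a ≤ b) (a :: t ++ rows.filterMap fun r => r[0]?) *
              cls (fun a b : A => a ≤ b) (rows.map List.tail).flatten := by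
            rw [cls_append, ih', cls_append, mul_assoc]
        _ = _ := by
            rw [h₁, ← cls_append, ← cls_append]
            simp

/-- The row reading of a tableau is plactic equivalent to its column reading. -/
theorem cls_flatten_eq_columns {rows : List (List A)} (n : ℕ)
    (hs : ∀ r ∈ rows, r.Pairwise (· ≤ ·)) (h : rows.Pairwise RowGT)
    (hn : ∀ r ∈ rows, r.length ≤ n) :
    cls (fun a b : A => a ≤ b) rows.flatten = cls (fun a b : A => a ≤ b)
      ((List.range n).map fun j => rows.filterMap fun r => r[j]?).flatten := by
  induction n generalizing rows with
  | zero =>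
    have : rows.flatten = [] := by
      simpa [List.flatten_eq_nil_iff] using hn
    rw [this]
    rfl
  | succ n ih =>
    have h₁ := ih (rows := rows.map List.tail) (by simpa using fun r hr => (hs r hr).tail)
      (h.map _ fun _ _ => RowGT.tail) (by simpa using hn)
    rw [cls_flatten_eq_first_column hs h, h₁, ← cls_append, List.range_succ_eq_map]
    simp [List.filterMap_map, Function.comp_def]

theorem above_column {s : List (List A)} (j : ℕ) (hs : ∀ r ∈ s, r.Pairwise (· ≤ ·))
    (hl : s.Pairwise fun a b => b.length ≤ a.length) :
    Above (fun a b : A => a < b) (s.filterMap fun r => r[j + 1]?) (s.filterMap fun r => r[j]?) := by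
  induction s with
  | nil => simp
  | cons r s ih =>
    rw [List.forall_mem_cons] at hs
    rw [List.pairwise_cons] at hl
    by_cases hj : j + 1 < r.length
    · have hj' : j < r.length := by omega
      simp only [List.filterMap_cons, List.getElem?_eq_getElem hj, List.getElem?_eq_getElem hj']
      exact ⟨not_lt.2 (List.pairwise_iff_getElem.1 hs.1 j (j + 1) hj' hj (by omega)),
        ih hs.2 hl.2⟩
    · have : (r :: s).filterMap (fun r => r[j + 1]?) = [] := by
        rw [List.filterMap_eq_nil_iff, List.forall_mem_cons]
        refine ⟨List.getElem?_eq_none (by omega), fun t ht => List.getElem?_eq_none ?_⟩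
        have := hl.1 t ht
        omega
      rw [this]
      exact above_nil _

namespace Tableau

@[simp] theorem length_cols (T : Tableau A) : T.cols.length = T.numCols := by simp [cols]

theorem reverse_cols_ne_nil (T : Tableau A) : ∀ c ∈ T.cols.map List.reverse, c ≠ [] := by
  simp only [cols, List.map_map, List.mem_map, List.mem_range, Function.comp_apply]
  rintro _ ⟨j, hj, rfl⟩
  unfold numCols at hj
  rcases List.eq_nil_or_concat T.rows with h | ⟨l, b, h⟩
  · simp [h] at hj
  · simp only [h, List.concat_eq_append, List.getLast?_concat, Option.getD_some] at hj
    simp [h, List.filterMap_append, List.getElem?_eq_getElem hj]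

/-- The columns of a tableau from left to right, each read from bottom to top, form a stack of
rows for the relation `<`. -/
theorem isStack_cols (T : Tableau A) :
    IsStack (fun a b : A => a < b) (T.cols.map List.reverse) := by
  refine ⟨?_, ?_⟩
  · simp only [cols, List.map_map, List.mem_map, List.mem_range, Function.comp_apply]
    rintro _ ⟨j, -, rfl⟩
    exact List.pairwise_reverse.2 (pairwise_column T.pairwise_rows j)
  · rw [List.isChain_iff_getElem]
    intro j hj
    simp only [cols, List.getElem_map, List.getElem_range, ← List.filterMap_reverse]
    refine above_column j (fun r hr => T.row_sorted r (List.mem_reverse.1 hr)) ?_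
    exact List.pairwise_reverse.2 (T.pairwise_rows.imp fun h => h.1)

theorem cls_reading_cols (T : Tableau A) :
    cls (fun a b : A => a < b) (reading (T.cols.map List.reverse)) =
      cls (fun a b : A => a < b) T.rowReading.reverse := by
  have h := cls_flatten_eq_columns T.numCols T.row_sorted T.pairwise_rows T.length_le_numCols
  rw [reading, ← List.reverse_flatten]
  exact (cls_reverse_eq_iff.2 h).symm

/-- Reversal is an anti-isomorphism from the plactic monoid of `≤` to that of `<`. -/
theorem cls_reverse_star (T T' : Tableau A) :
    cls (fun a b : A => a < b) (T.star T').rowReading.reverse =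
      cls (fun a b : A => a < b) T'.rowReading.reverse *
        cls (fun a b : A => a < b) T.rowReading.reverse := by
  rw [← cls_append, ← List.reverse_append, cls_reverse_eq_iff, cls_star, cls_append]

end Tableau

/-! ### Decorated tableaux as stacks -/

/-- The rows of a decorated tableau from bottom to top, followed by as many empty rows as the
decoration says. -/
def rowStack (p : DecTableau A) : Stack (fun a b : A => a ≤ b) :=
  ⟨p.1.rows.reverse ++ List.replicate p.2 [], p.1.isStack_rows.append_replicate _⟩

/-- The columns of a decorated tableau from left to right, each read from bottom to top, followed
by as many empty columns as the decoration says. -/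
def colStack (p : DecTableau A) : Stack (fun a b : A => a < b) :=
  ⟨p.1.cols.map List.reverse ++ List.replicate p.2 [], p.1.isStack_cols.append_replicate _⟩

@[simp] theorem length_rowStack (p : DecTableau A) :
    (rowStack p).1.length = p.1.numRows + p.2 := by
  simp [rowStack, Tableau.numRows]

@[simp] theorem length_colStack (p : DecTableau A) :
    (colStack p).1.length = p.1.numCols + p.2 := by
  simp [colStack]

theorem cls_rowStack (p : DecTableau A) : cls (fun a b : A => a ≤ b) (reading (rowStack p).1) =
    cls (fun a b : A => a ≤ b) p.1.rowReading := by
  simp [rowStack, reading_append, Tableau.reading_reverse_rows]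

theorem cls_colStack (p : DecTableau A) : cls (fun a b : A => a < b) (reading (colStack p).1) =
    cls (fun a b : A => a < b) p.1.rowReading.reverse := by
  simp [colStack, reading_append, Tableau.cls_reading_cols]

theorem numRows_le_length {T : Tableau A} {s : List (List A)}
    (hs : IsStack (fun a b : A => a ≤ b) s) (h : cls (fun a b : A => a ≤ b) T.rowReading =
      cls (fun a b : A => a ≤ b) (reading s)) : T.numRows ≤ s.length := by
  rw [← T.reading_reverse_rows] at h
  simpa [Tableau.numRows] using T.isStack_rows.length_le hs T.reverse_rows_ne_nil h

theorem numCols_le_length {T : Tableau A} {s : List (List A)}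
    (hs : IsStack (fun a b : A => a < b) s) (h : cls (fun a b : A => a < b) T.rowReading.reverse =
      cls (fun a b : A => a < b) (reading s)) : T.numCols ≤ s.length := by
  rw [← T.cls_reading_cols] at h
  simpa using T.isStack_cols.length_le hs T.reverse_cols_ne_nil h

theorem numRows_star_le (T T' : Tableau A) : (T.star T').numRows ≤ T.numRows + T'.numRows := by
  have h := numRows_le_length (T := T.star T') (stackMul (rowStack (T, 0)) (rowStack (T', 0))).2
    (by rw [cls_stackMul, cls_rowStack, cls_rowStack, Tableau.cls_star])
  simpa using h

theorem numCols_star_le (T T' : Tableau A) : (T.star T').numCols ≤ T.numCols + T'.numCols := by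
  have h := numCols_le_length (T := T.star T') (stackMul (colStack (T', 0)) (colStack (T, 0))).2
    (by rw [cls_stackMul, cls_colStack, cls_colStack, Tableau.cls_reverse_star])
  simpa [add_comm] using h

/-- The decoration of a row product counts the empty rows of the product of stacks. -/
theorem rowStack_rowMul (p q : DecTableau A) :
    rowStack (rowMul p q) = stackMul (rowStack p) (rowStack q) := by
  refine stack_ext ?_ ?_
  · have := numRows_star_le p.1 q.1
    simp [rowMul]
    omega
  · rw [cls_stackMul, cls_rowStack, cls_rowStack, cls_rowStack, rowMul, Tableau.cls_star]

/-- Reversing words makes the column product the opposite of the product of `<`-stacks. -/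
theorem colStack_colMul (p q : DecTableau A) :
    colStack (colMul p q) = stackMul (colStack q) (colStack p) := by
  refine stack_ext ?_ ?_
  · have := numCols_star_le p.1 q.1
    simp [colMul]
    omega
  · rw [cls_stackMul, cls_colStack, cls_colStack, cls_colStack, colMul, Tableau.cls_reverse_star]

theorem rowStack_bijective : Function.Bijective (rowStack (A := A)) := by
  constructor
  · rintro ⟨T, α⟩ ⟨T', α'⟩ h
    obtain rfl : T = T' := Tableau.eq_of_cls_eq (by
      have := congrArg (fun s => cls (fun a b : A => a ≤ b) (reading s.1)) h
      simpa only [cls_rowStack] using this)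
    have := congrArg (fun s => s.1.length) h
    simp only [length_rowStack] at this
    rw [Nat.add_left_cancel this]
  · intro s
    have h : cls (fun a b : A => a ≤ b) ((Tableau.empty A).insertWord (reading s.1)).rowReading =
        cls (fun a b : A => a ≤ b) (reading s.1) := by
      rw [Tableau.cls_insertWord]
      exact one_mul _
    refine ⟨((Tableau.empty A).insertWord (reading s.1),
      s.1.length - ((Tableau.empty A).insertWord (reading s.1)).numRows),
      stack_ext ?_ (by rw [cls_rowStack, h])⟩
    have := numRows_le_length s.2 h
    simp; omega

theorem colStack_bijective : Function.Bijective (colStack (A := A)) := by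
  constructor
  · rintro ⟨T, α⟩ ⟨T', α'⟩ h
    obtain rfl : T = T' := Tableau.eq_of_cls_eq (cls_reverse_eq_iff.1 (by
      have := congrArg (fun s => cls (fun a b : A => a < b) (reading s.1)) h
      simpa only [cls_colStack] using this))
    have := congrArg (fun s => s.1.length) h
    simp only [length_colStack] at this
    rw [Nat.add_left_cancel this]
  · intro s
    have h : cls (fun a b : A => a < b)
        ((Tableau.empty A).insertWord (reading s.1).reverse).rowReading.reverse =
          cls (fun a b : A => a < b) (reading s.1) := by
      conv_rhs => rw [← List.reverse_reverse (reading s.1)]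
      rw [cls_reverse_eq_iff, Tableau.cls_insertWord]
      exact one_mul _
    refine ⟨((Tableau.empty A).insertWord (reading s.1).reverse,
      s.1.length - ((Tableau.empty A).insertWord (reading s.1).reverse).numCols),
      stack_ext ?_ (by rw [cls_colStack, h])⟩
    have := numCols_le_length s.2 h
    simp; omega

/-! ### The conditions characterizing the braidings -/

omit [LinearOrder A] in
/-- Two stacks of non-empty rows `a` and `b`, padded with empty rows, fit together exactly if no
empty row of the lower one lies beneath a row of the upper one. -/
theorem append_replicate_eq_iff {a b c : List (List A)} {k l n₁ n₂ : ℕ}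
    (ha : ∀ r ∈ a, r ≠ []) (hb : ∀ r ∈ b, r ≠ []) (hc : ∀ r ∈ c, r ≠ [])
    (hle : c.length ≤ n₁ + n₂) (h₁ : k + a.length = n₁) (h₂ : l + b.length = n₂) :
    (a ++ List.replicate k []) ++ (b ++ List.replicate l []) =
        c ++ List.replicate (n₁ + n₂ - c.length) [] ↔
      a ++ b = c ∧ (0 < k ↔ c.length < n₁) ∧ (c.length < n₁ → b = []) := by
  have hfilter : ∀ d : List (List A), (∀ r ∈ d, r ≠ []) →
      d.filter (fun r => !r.isEmpty) = d := fun d hd =>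
    List.filter_eq_self.2 fun r hr => by simpa using hd r hr
  constructor
  · intro h
    obtain rfl : a ++ b = c := by
      have := congrArg (List.filter fun r => !r.isEmpty) h
      simpa [hfilter a ha, hfilter b hb, hfilter c hc] using this
    have hk : 0 < k → b = [] := by
      intro hk
      obtain ⟨k, rfl⟩ := Nat.exists_eq_add_of_lt hk
      cases b with
      | nil => rfl
      | cons x b =>
        simp only [List.append_assoc, List.append_cancel_left_eq, zero_add,
          List.replicate_succ, List.cons_append, List.cons.injEq] at h
        exact (hb x (by simp) h.1.symm).elim
    have hk' : 0 < k ↔ (a ++ b).length < n₁ := by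
      constructor
      · intro h'
        simp [hk h']
        omega
      · intro h'
        simp at h'
        omega
    exact ⟨rfl, hk', fun h' => hk (hk'.2 h')⟩
  · rintro ⟨rfl, h₃, h₄⟩
    have hkl : n₁ + n₂ - (a ++ b).length = k + l := by
      rw [List.length_append]
      omega
    rw [hkl, List.replicate_add]
    rcases Nat.eq_zero_or_pos k with rfl | hk
    · simp
    · obtain rfl := h₄ (h₃.1 hk)
      simp

/-- The bottom part of the product of stacks comes from `T₁`, its top part from `T₂`. -/
theorem rowBraidValue_iff (T₁ : Tableau A) (α₁ : ℕ) (T₂ : Tableau A) (α₂ : ℕ) (T₂' : Tableau A)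
    (α₂' : ℕ) (T₁' : Tableau A) (α₁' : ℕ) :
    stackBraid (rowStack (T₁, α₁), rowStack (T₂, α₂)) =
        (rowStack (T₂', α₂'), rowStack (T₁', α₁')) ↔
      IsRowBraidValue T₁ α₁ T₂ α₂ T₂' α₂' T₁' α₁' := by
  have hle := numRows_star_le T₁ T₂
  have hadd : α₁ + α₂ + T₁.numRows + T₂.numRows = (α₁ + T₁.numRows) + (α₂ + T₂.numRows) := by
    omega
  have key := fun (h₁ : α₁' + T₁'.numRows = α₁ + T₁.numRows)
    (h₂ : α₂' + T₂'.numRows = α₂ + T₂.numRows) =>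
    append_replicate_eq_iff T₁'.reverse_rows_ne_nil T₂'.reverse_rows_ne_nil
      (T₁.star T₂).reverse_rows_ne_nil (k := α₁') (l := α₂') (n₁ := α₁ + T₁.numRows)
      (n₂ := α₂ + T₂.numRows) (by simp [Tableau.length_rows]; omega)
      (by simpa [Tableau.length_rows] using h₁) (by simpa [Tableau.length_rows] using h₂)
  have hnil : T₂'.rows.reverse = [] ↔ T₂' = Tableau.empty A := by
    simp [Tableau.ext_iff, Tableau.empty]
  rw [stackBraid_eq_iff_append, ← rowStack_rowMul]
  simp only [length_rowStack]
  simp only [rowStack, rowMul, hadd]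
  simp only [← List.reverse_append, List.reverse_inj, List.length_reverse, Tableau.length_rows,
    hnil] at key
  constructor
  · rintro ⟨h, h₁, h₂⟩
    obtain ⟨k₁, k₂, k₃⟩ := (key (by omega) (by omega)).1 h
    exact ⟨k₁, by omega, by omega, k₂, k₃⟩
  · rintro ⟨k₁, h₁, h₂, k₂, k₃⟩
    exact ⟨(key h₁ h₂).2 ⟨k₁, k₂, k₃⟩, by omega, by omega⟩

theorem Tableau.cols_eq_nil_iff {T : Tableau A} : T.cols = [] ↔ T = Tableau.empty A := by
  constructor
  · intro h
    have h₁ : cls (fun a b : A => a < b) T.rowReading.reverse = cls (fun a b : A => a < b)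
        (Tableau.empty A).rowReading.reverse := by
      rw [← T.cls_reading_cols, h]
      rfl
    exact Tableau.eq_of_cls_eq (cls_reverse_eq_iff.1 h₁)
  · rintro rfl
    rfl

/-- In the stack of columns the left part of the product, which comes from `T₂`, is the bottom
part, so the factors appear in the opposite order. -/
theorem colBraidValue_iff (T₁ : Tableau A) (α₁ : ℕ) (T₂ : Tableau A) (α₂ : ℕ) (T₂' : Tableau A)
    (α₂' : ℕ) (T₁' : Tableau A) (α₁' : ℕ) :
    stackBraid (colStack (T₂, α₂), colStack (T₁, α₁)) =
        (colStack (T₁', α₁'), colStack (T₂', α₂')) ↔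
      IsColBraidValue T₁ α₁ T₂ α₂ T₂' α₂' T₁' α₁' := by
  have hle := numCols_star_le T₁ T₂
  have hadd : α₁ + α₂ + T₁.numCols + T₂.numCols = (α₂ + T₂.numCols) + (α₁ + T₁.numCols) := by
    omega
  have key := fun (h₁ : α₁' + T₁'.numCols = α₁ + T₁.numCols)
    (h₂ : α₂' + T₂'.numCols = α₂ + T₂.numCols) =>
    append_replicate_eq_iff T₂'.reverse_cols_ne_nil T₁'.reverse_cols_ne_nil
      (T₁.star T₂).reverse_cols_ne_nil (k := α₂') (l := α₁') (n₁ := α₂ + T₂.numCols)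
      (n₂ := α₁ + T₁.numCols) (by simp; omega) (by simpa using h₂) (by simpa using h₁)
  rw [stackBraid_eq_iff_append, ← colStack_colMul]
  simp only [length_colStack]
  simp only [colStack, colMul, hadd]
  simp only [← List.map_append, List.map_inj_right fun _ _ => List.reverse_inj.1,
    List.length_map, Tableau.length_cols, List.map_eq_nil_iff, Tableau.cols_eq_nil_iff] at key
  constructor
  · rintro ⟨h, h₁, h₂⟩
    obtain ⟨k₁, k₂, k₃⟩ := (key (by omega) (by omega)).1 h
    exact ⟨k₁, by omega, by omega, k₂, k₃⟩
  · rintro ⟨k₁, h₁, h₂, k₂, k₃⟩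
    exact ⟨(key h₁ h₂).2 ⟨k₁, k₂, k₃⟩, by omega, by omega⟩

end

/-! ### Transport of braided commutative monoids -/

/-- The opposite of a braided commutative monoid, with the braiding conjugated by the flip. -/
theorem IsBraidedCommMonoid.op {M : Type*} {mul : M → M → M} {one : M} {σ : M × M → M × M}
    (h : IsBraidedCommMonoid mul one σ) :
    IsBraidedCommMonoid (fun a b => mul b a) one (fun p => (σ p.swap).swap) where
  mul_assoc u v w := (h.mul_assoc w v u).symm
  one_mul := h.mul_one
  mul_one := h.one_mul
  braiding := fun ⟨u, v, w⟩ => by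
    have := h.braiding (w, v, u)
    simp only [onFirstTwo, onLastTwo, Prod.ext_iff, Prod.swap] at this ⊢
    exact ⟨this.2.2.symm, this.2.1.symm, this.1.symm⟩
  braid_mul_left u v w w' v' w'' u' h₁ h₂ := by
    have h₃ := h.braid_mul_right w v u v' w' u' w'' (by simpa using congrArg Prod.swap h₁)
      (by simpa using congrArg Prod.swap h₂)
    simp [h₃]
  braid_mul_right u v w v' u' w' u'' h₁ h₂ := by
    have h₃ := h.braid_mul_left w v u u' v' u'' w' (by simpa using congrArg Prod.swap h₁)
      (by simpa using congrArg Prod.swap h₂)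
    simp [h₃]
  braided_comm v w w' v' h₁ := h.braided_comm w v v' w' (by simpa using congrArg Prod.swap h₁)
  braid_one_left w := by simp [h.braid_one_right]
  braid_one_right v := by simp [h.braid_one_left]

theorem IsBraidedCommMonoid.of_equiv {M N : Type*} {mul : M → M → M} {one : M}
    {mul' : N → N → N} {one' : N} {σ : N × N → N × N} (h : IsBraidedCommMonoid mul' one' σ)
    (e : M ≃ N) (hmul : ∀ a b, e (mul a b) = mul' (e a) (e b)) (hone : e one = one') :
    IsBraidedCommMonoid mul one (fun p => (e.prodCongr e).symm (σ (e.prodCongr e p))) := by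
  have hσ : ∀ a b c d, (e.prodCongr e).symm (σ (e.prodCongr e (a, b))) = (c, d) ↔
      σ (e a, e b) = (e c, e d) := fun a b c d => by
    rw [Equiv.symm_apply_eq]
    rfl
  refine
    { mul_assoc := fun u v w => e.injective (by simp [hmul, h.mul_assoc])
      one_mul := fun u => e.injective (by simp [hmul, hone, h.one_mul])
      mul_one := fun u => e.injective (by simp [hmul, hone, h.mul_one])
      braiding := fun ⟨u, v, w⟩ => ?_
      braid_mul_left := fun u v w w' v' w'' u' h₁ h₂ => ?_
      braid_mul_right := fun u v w v' u' w' u'' h₁ h₂ => ?_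
      braided_comm := fun v w w' v' h₁ => e.injective ?_
      braid_one_left := fun w => by rw [hσ, hone, h.braid_one_left]
      braid_one_right := fun v => by rw [hσ, hone, h.braid_one_right] }
  · have := h.braiding (e u, e v, e w)
    simp only [onFirstTwo, onLastTwo, Prod.ext_iff] at this
    simpa [onFirstTwo, onLastTwo, Prod.ext_iff] using this
  · rw [hσ] at h₁ h₂ ⊢
    rw [hmul, hmul]
    exact h.braid_mul_left _ _ _ _ _ _ _ h₁ h₂
  · rw [hσ] at h₁ h₂ ⊢
    rw [hmul, hmul]
    exact h.braid_mul_right _ _ _ _ _ _ _ h₁ h₂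
  · rw [hσ] at h₁
    rw [hmul, hmul]
    exact h.braided_comm _ _ _ _ h₁

end Plactic

theorem theoremT {A : Type*} [LinearOrder A] :
    -- row structure (the first conjunct says that the subtraction in `rowMul` is never truncated)
    ((∀ T₁ T₂ : Plactic.Tableau A, (T₁.star T₂).numRows ≤ T₁.numRows + T₂.numRows) ∧
      ∃ σ : Plactic.DecTableau A × Plactic.DecTableau A →
          Plactic.DecTableau A × Plactic.DecTableau A,
        (∀ (T₁ : Plactic.Tableau A) (α₁ : ℕ) (T₂ : Plactic.Tableau A) (α₂ : ℕ)
            (T₂' : Plactic.Tableau A) (α₂' : ℕ) (T₁' : Plactic.Tableau A) (α₁' : ℕ),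
          σ ((T₁, α₁), (T₂, α₂)) = ((T₂', α₂'), (T₁', α₁')) ↔
            Plactic.IsRowBraidValue T₁ α₁ T₂ α₂ T₂' α₂' T₁' α₁') ∧
        Plactic.IsBraidedCommMonoid Plactic.rowMul (Plactic.Tableau.empty A, 0) σ) ∧
    -- column structure (likewise for `colMul`)
    ((∀ T₁ T₂ : Plactic.Tableau A, (T₁.star T₂).numCols ≤ T₁.numCols + T₂.numCols) ∧
      ∃ σ : Plactic.DecTableau A × Plactic.DecTableau A →
          Plactic.DecTableau A × Plactic.DecTableau A,
        (∀ (T₁ : Plactic.Tableau A) (α₁ : ℕ) (T₂ : Plactic.Tableau A) (α₂ : ℕ)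
            (T₂' : Plactic.Tableau A) (α₂' : ℕ) (T₁' : Plactic.Tableau A) (α₁' : ℕ),
          σ ((T₁, α₁), (T₂, α₂)) = ((T₂', α₂'), (T₁', α₁')) ↔
            Plactic.IsColBraidValue T₁ α₁ T₂ α₂ T₂' α₂' T₁' α₁') ∧
        Plactic.IsBraidedCommMonoid Plactic.colMul (Plactic.Tableau.empty A, 0) σ) := by
  open Plactic in
  refine ⟨⟨numRows_star_le, _, fun T₁ α₁ T₂ α₂ T₂' α₂' T₁' α₁' => ?_,
      isBraidedCommMonoid_stack.of_equiv (Equiv.ofBijective _ rowStack_bijective)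
        rowStack_rowMul rfl⟩,
    ⟨numCols_star_le, _, fun T₁ α₁ T₂ α₂ T₂' α₂' T₁' α₁' => ?_,
      isBraidedCommMonoid_stack.op.of_equiv (Equiv.ofBijective _ colStack_bijective)
        colStack_colMul rfl⟩⟩
  · rw [← rowBraidValue_iff, Equiv.symm_apply_eq]
    rfl
  · rw [← colBraidValue_iff, Equiv.symm_apply_eq, ← Prod.swap_inj]
    rfl
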